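/- Let $\mathcal V$ be a (one-sorted, finitary) variety of algebras which, as a category, is semi-abelian (pointed, Barr exact, Bourn protomodular, with binary coproducts), and suppose that $\mathcal V$ is non-trivial, i.e. some algebra of $\mathcal V$ has at least two elements. Let $\mathrm{XMod}(\mathcal V)$ be the category of internal crossed modules in $\mathcal V$. Its objects are quadruples $(T,G,\psi,\partial)$ with $\partial\colon T\to G$ a morphism and $\psi\colon G\diamond T\to T$ the action core of a split extension of $G$ by $T$, where $G\diamond T=\ker(G+T\to G\times T)$ is the cosmash product, satisfying the precrossed module, Peiffer and ternary commutator conditions; its morphisms are the equivariant pairs of morphisms compatible with the boundaries $\partial$. Regard $\mathrm{XMod}(\mathcal V)$ as a variety via the forgetful functor $\mathrm{XMod}(\mathcal V)\to\mathbf{Set}$ sending $(T,G,\psi,\partial)$ to the underlying set of $T\times G$; its free objects are the objects free on a set with respect to this functor. Then: 1. $\mathrm{XMod}(\mathcal V)$ is not a Schreier variety: some subobject of a free object of $\mathrm{XMod}(\mathcal V)$ is not free. 2. More precisely, there are an object $P$ of $\mathcal V$ that is projective (with respect to regular epimorphisms) and a split extension $0\to Q\xrightarrow{k} Z\rightleftarrows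 P\to 0$ that is projective in the category of split extensions over $P$, such that the kernel $k\colon Q\to Z$, with its natural (conjugation) crossed module structure, is a projective object of $\mathrm{XMod}(\mathcal V)$, is not free, and is a subobject of a free object of $\mathrm{XMod}(\mathcal V)$. -/

import Mathlib

open CategoryTheory Limits

universe u v w

noncomputable section

namespace SemiAb

/-! ### Split extensions, projective objects and semi-abelian categories -/

section General

variable {C : Type u} [Category.{v} C]

/-- `P` is projective with respect to regular epimorphisms. -/
def IsRegularProjective (P : C) : Prop :=
  ∀ ⦃X Y : C⦄ (e : X ⟶ Y) [IsRegularEpi e] (f : P ⟶ Y), ∃ g : P ⟶ X, g ≫ e = f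

variable [HasZeroMorphisms C]

lemma mono_of_isKernel {Y E B : C} (k : Y ⟶ E) (p : E ⟶ B) (zero : k ≫ p = 0)
    (hk : IsLimit (KernelFork.ofι k zero)) : Mono k := mono_of_isLimit_fork hk

/-- A split extension `0 ⟶ X ⟶ E ⇄ B ⟶ 0` of `B` with kernel object `X`: the morphism `p` is split
by `s`, and `k` is a kernel of `p`. -/
structure SplitExt (X B : C) where
  E : C
  k : X ⟶ E
  p : E ⟶ B
  s : B ⟶ E
  splitting : s ≫ p = 𝟙 B
  zero : k ≫ p = 0
  isKernel : Nonempty (IsLimit (KernelFork.ofι k zero))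

/-- The objects of the category of split extensions over a fixed object `B`. -/
structure SSE (B : C) where
  X : C
  ext : SplitExt X B

/-- A morphism of split extensions over `B`: a pair `(f, g)` that is compatible with the kernels,
the retractions and the sections, and is the identity on `B`. -/
@[ext]
structure SSE.Hom {B : C} (S T : SSE B) where
  f : S.X ⟶ T.X
  g : S.ext.E ⟶ T.ext.E
  comm_k : S.ext.k ≫ g = f ≫ T.ext.k
  comm_p : g ≫ T.ext.p = S.ext.p
  comm_s : S.ext.s ≫ g = T.ext.s

instance {B : C} : Category (SSE B) where
  Hom := SSE.Hom
  id S := ⟨𝟙 _, 𝟙 _, by simp, by simp, by simp⟩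
  comp F G := ⟨F.f ≫ G.f, F.g ≫ G.g, by
      rw [← Category.assoc, F.comm_k, Category.assoc, G.comm_k, Category.assoc], by
      rw [Category.assoc, G.comm_p, F.comm_p], by
      rw [← Category.assoc, F.comm_s, G.comm_s]⟩
  id_comp _ := SSE.Hom.ext (Category.id_comp _) (Category.id_comp _)
  comp_id _ := SSE.Hom.ext (Category.comp_id _) (Category.comp_id _)
  assoc _ _ _ := SSE.Hom.ext (Category.assoc _ _ _) (Category.assoc _ _ _)

variable (C) in
/-- A semi-abelian category: pointed, Barr exact (regular, with every internal equivalence relation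
a kernel pair), Bourn protomodular (which, in the pointed case, is the Split Short Five Lemma), and
with binary coproducts. -/
class SemiAbelian : Prop extends Regular C, HasZeroObject C, HasBinaryCoproducts C where
  effective : ∀ {R X : C} (p₁ p₂ : R ⟶ X) [IsEquivalenceRelation p₁ p₂],
    ∃ (Y : C) (q : X ⟶ Y), IsKernelPair q p₁ p₂
  protomodular : ∀ {X B X' B' : C} (S : SplitExt X B) (S' : SplitExt X' B')
    (f : X ⟶ X') (g : S.E ⟶ S'.E) (h : B ⟶ B'), S.k ≫ g = f ≫ S'.k → g ≫ S'.p = S.p ≫ h →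
    S.s ≫ g = h ≫ S'.s → IsIso f → IsIso h → IsIso g

end General

/-! ### Cosmash products and internal crossed modules -/

section Cosmash

attribute [local simp] coprod.inl_desc coprod.inr_desc coprod.inl_desc_assoc coprod.inr_desc_assoc
  prod.lift_fst prod.lift_snd prod.lift_fst_assoc prod.lift_snd_assoc pullback.lift_fst
  pullback.lift_snd pullback.lift_fst_assoc pullback.lift_snd_assoc

variable {C : Type u} [Category.{v} C] [HasZeroMorphisms C] [SemiAbelian C]

/-- The comparison morphism `A + B ⟶ A × B`. -/
def sigma₂ (A B : C) : A ⨿ B ⟶ A ⨯ B :=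
  coprod.desc (prod.lift (𝟙 A) 0) (prod.lift 0 (𝟙 B))

/-- The binary cosmash product. -/
def cosmash (A B : C) : C := kernel (sigma₂ A B)

/-- The inclusion of the binary cosmash product in the coproduct. -/
def cosmashι (A B : C) : cosmash A B ⟶ A ⨿ B := kernel.ι (sigma₂ A B)

instance (A B : C) : Mono (cosmashι A B) := inferInstanceAs (Mono (kernel.ι _))

lemma cosmashι_sigma₂ (A B : C) : cosmashι A B ≫ sigma₂ A B = 0 := kernel.condition _

lemma cosmashι_left (A B : C) : cosmashι A B ≫ coprod.desc (𝟙 A) 0 = 0 := by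
  have h : sigma₂ A B ≫ prod.fst = coprod.desc (𝟙 A) 0 := by
    ext <;> simp [sigma₂]
  rw [← h, ← Category.assoc, cosmashι_sigma₂, zero_comp]

lemma cosmashι_left_assoc (A B : C) {W : C} (f : A ⟶ W) :
    cosmashι A B ≫ coprod.desc (𝟙 A) 0 ≫ f = 0 := by
  rw [← Category.assoc, cosmashι_left, zero_comp]

lemma cosmashι_right (A B : C) : cosmashι A B ≫ coprod.desc 0 (𝟙 B) = 0 := by
  have h : sigma₂ A B ≫ prod.snd = coprod.desc 0 (𝟙 B) := by
    ext <;> simp [sigma₂]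
  rw [← h, ← Category.assoc, cosmashι_sigma₂, zero_comp]

lemma cosmashι_right_assoc (A B : C) {W : C} (f : B ⟶ W) :
    cosmashι A B ≫ coprod.desc 0 (𝟙 B) ≫ f = 0 := by
  rw [← Category.assoc, cosmashι_right, zero_comp]

/-- A morphism into `A + B` that vanishes in `A` and in `B` factors through the cosmash product. -/
def cosmashLift {A B W : C} (f : W ⟶ A ⨿ B) (h₁ : f ≫ coprod.desc (𝟙 A) 0 = 0)
    (h₂ : f ≫ coprod.desc 0 (𝟙 B) = 0) : W ⟶ cosmash A B :=
  kernel.lift (sigma₂ A B) f (by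
    have e₁ : sigma₂ A B ≫ prod.fst = coprod.desc (𝟙 A) 0 := by ext <;> simp [sigma₂]
    have e₂ : sigma₂ A B ≫ prod.snd = coprod.desc 0 (𝟙 B) := by ext <;> simp [sigma₂]
    apply Limits.prod.hom_ext
    · rw [Category.assoc, e₁, h₁, zero_comp]
    · rw [Category.assoc, e₂, h₂, zero_comp])

@[simp]
lemma cosmashLift_ι {A B W : C} (f : W ⟶ A ⨿ B) (h₁ : f ≫ coprod.desc (𝟙 A) 0 = 0)
    (h₂ : f ≫ coprod.desc 0 (𝟙 B) = 0) : cosmashLift f h₁ h₂ ≫ cosmashι A B = f :=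
  kernel.lift_ι _ _ _

/-- Functoriality of the binary cosmash product. -/
def cosmashMap {A A' B B' : C} (f : A ⟶ A') (g : B ⟶ B') : cosmash A B ⟶ cosmash A' B' :=
  cosmashLift (cosmashι A B ≫ coprod.map f g)
    (by
      have h : coprod.map f g ≫ coprod.desc (𝟙 A') 0 = coprod.desc (𝟙 A) 0 ≫ f := by
        ext <;> simp
      rw [Category.assoc, h, cosmashι_left_assoc])
    (by
      have h : coprod.map f g ≫ coprod.desc 0 (𝟙 B') = coprod.desc 0 (𝟙 B) ≫ g := by
        ext <;> simp
      rw [Category.assoc, h, cosmashι_right_assoc])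

@[simp]
lemma cosmashMap_ι {A A' B B' : C} (f : A ⟶ A') (g : B ⟶ B') :
    cosmashMap f g ≫ cosmashι A' B' = cosmashι A B ≫ coprod.map f g :=
  cosmashLift_ι _ _ _

@[simp]
lemma cosmashMap_ι_assoc {A A' B B' : C} (f : A ⟶ A') (g : B ⟶ B') {Z : C} (q : A' ⨿ B' ⟶ Z) :
    cosmashMap f g ≫ cosmashι A' B' ≫ q = cosmashι A B ≫ coprod.map f g ≫ q := by
  rw [← Category.assoc, cosmashMap_ι, Category.assoc]

lemma cosmashMap_id (A B : C) : cosmashMap (𝟙 A) (𝟙 B) = 𝟙 (cosmash A B) := by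
  rw [← cancel_mono (cosmashι A B)]; simp

lemma cosmashMap_comp {A A' A'' B B' B'' : C} (f : A ⟶ A') (f' : A' ⟶ A'') (g : B ⟶ B')
    (g' : B' ⟶ B'') : cosmashMap (f ≫ f') (g ≫ g') = cosmashMap f g ≫ cosmashMap f' g' := by
  rw [← cancel_mono (cosmashι A'' B'')]; simp

/-- The comparison morphism `A + B + C ⟶ (A + B) × (A + C) × (B + C)`. -/
def sigma₃ (A B D : C) : (A ⨿ B) ⨿ D ⟶ (A ⨿ B) ⨯ ((A ⨿ D) ⨯ (B ⨿ D)) :=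
  prod.lift (coprod.desc (𝟙 (A ⨿ B)) 0)
    (prod.lift (coprod.map (coprod.desc (𝟙 A) 0) (𝟙 D))
      (coprod.map (coprod.desc 0 (𝟙 B)) (𝟙 D)))

/-- The ternary cosmash product. -/
def cosmash₃ (A B D : C) : C := kernel (sigma₃ A B D)

/-- The inclusion of the ternary cosmash product in the coproduct. -/
def cosmash₃ι (A B D : C) : cosmash₃ A B D ⟶ (A ⨿ B) ⨿ D := kernel.ι (sigma₃ A B D)

instance (A B D : C) : Mono (cosmash₃ι A B D) := inferInstanceAs (Mono (kernel.ι _))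

lemma cosmash₃ι_sigma₃ (A B D : C) : cosmash₃ι A B D ≫ sigma₃ A B D = 0 :=
  kernel.condition _

lemma cosmash₃ι_12 (A B D : C) : cosmash₃ι A B D ≫ coprod.desc (𝟙 (A ⨿ B)) 0 = 0 := by
  have h := cosmash₃ι_sigma₃ A B D =≫ prod.fst
  simpa [sigma₃] using h

lemma cosmash₃ι_12_assoc (A B D : C) {W : C} (f : A ⨿ B ⟶ W) :
    cosmash₃ι A B D ≫ coprod.desc (𝟙 (A ⨿ B)) 0 ≫ f = 0 := by
  rw [← Category.assoc, cosmash₃ι_12, zero_comp]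

lemma cosmash₃ι_13 (A B D : C) :
    cosmash₃ι A B D ≫ coprod.map (coprod.desc (𝟙 A) 0) (𝟙 D) = 0 := by
  have h := cosmash₃ι_sigma₃ A B D =≫ (prod.snd ≫ prod.fst)
  simpa [sigma₃] using h

lemma cosmash₃ι_13_assoc (A B D : C) {W : C} (f : A ⨿ D ⟶ W) :
    cosmash₃ι A B D ≫ coprod.map (coprod.desc (𝟙 A) 0) (𝟙 D) ≫ f = 0 := by
  rw [← Category.assoc, cosmash₃ι_13, zero_comp]

lemma cosmash₃ι_23 (A B D : C) :
    cosmash₃ι A B D ≫ coprod.map (coprod.desc 0 (𝟙 B)) (𝟙 D) = 0 := by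
  have h := cosmash₃ι_sigma₃ A B D =≫ (prod.snd ≫ prod.snd)
  simpa [sigma₃] using h

lemma cosmash₃ι_23_assoc (A B D : C) {W : C} (f : B ⨿ D ⟶ W) :
    cosmash₃ι A B D ≫ coprod.map (coprod.desc 0 (𝟙 B)) (𝟙 D) ≫ f = 0 := by
  rw [← Category.assoc, cosmash₃ι_23, zero_comp]

/-- Functoriality of the ternary cosmash product. -/
def cosmash₃Map {A A' B B' D D' : C} (f : A ⟶ A') (g : B ⟶ B') (h : D ⟶ D') :
    cosmash₃ A B D ⟶ cosmash₃ A' B' D' :=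
  kernel.map (sigma₃ A B D) (sigma₃ A' B' D') (coprod.map (coprod.map f g) h)
    (prod.map (coprod.map f g) (prod.map (coprod.map f h) (coprod.map g h)))
    (by
      ext <;> simp [sigma₃])

@[simp]
lemma cosmash₃Map_ι {A A' B B' D D' : C} (f : A ⟶ A') (g : B ⟶ B') (h : D ⟶ D') :
    cosmash₃Map f g h ≫ cosmash₃ι A' B' D' =
      cosmash₃ι A B D ≫ coprod.map (coprod.map f g) h :=
  kernel.lift_ι _ _ _

@[simp]
lemma cosmash₃Map_ι_assoc {A A' B B' D D' : C} (f : A ⟶ A') (g : B ⟶ B') (h : D ⟶ D') {Z : C} (q : (A' ⨿ B') ⨿ D' ⟶ Z) :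
    cosmash₃Map f g h ≫ cosmash₃ι A' B' D' ≫ q = cosmash₃ι A B D ≫ coprod.map (coprod.map f g) h ≫ q := by
  rw [← Category.assoc, cosmash₃Map_ι, Category.assoc]

/-- The folding morphism `S₂₁ : A ⋄ A ⋄ B ⟶ A ⋄ B`, the restriction of `(1 1) + 1`. -/
def fold₂₁ (A B : C) : cosmash₃ A A B ⟶ cosmash A B :=
  cosmashLift (cosmash₃ι A A B ≫ coprod.map (coprod.desc (𝟙 A) (𝟙 A)) (𝟙 B))
    (by
      have h : coprod.map (coprod.desc (𝟙 A) (𝟙 A)) (𝟙 B) ≫ coprod.desc (𝟙 A) 0 =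
          coprod.desc (𝟙 (A ⨿ A)) 0 ≫ coprod.desc (𝟙 A) (𝟙 A) := by
        ext <;> simp
      rw [Category.assoc, h, cosmash₃ι_12_assoc])
    (by
      have h : coprod.map (coprod.desc (𝟙 A) (𝟙 A)) (𝟙 B) ≫ coprod.desc 0 (𝟙 B) =
          coprod.map (coprod.desc (𝟙 A) 0) (𝟙 B) ≫ coprod.desc 0 (𝟙 B) := by
        ext <;> simp
      rw [Category.assoc, h, cosmash₃ι_13_assoc])

@[simp]
lemma fold₂₁_ι (A B : C) : fold₂₁ A B ≫ cosmashι A B =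
    cosmash₃ι A A B ≫ coprod.map (coprod.desc (𝟙 A) (𝟙 A)) (𝟙 B) :=
  cosmashLift_ι _ _ _

@[simp]
lemma fold₂₁_ι_assoc (A B : C) {Z : C} (q : A ⨿ B ⟶ Z) :
    fold₂₁ A B ≫ cosmashι A B ≫ q = cosmash₃ι A A B ≫ coprod.map (coprod.desc (𝟙 A) (𝟙 A)) (𝟙 B) ≫ q := by
  rw [← Category.assoc, fold₂₁_ι, Category.assoc]

/-- The folding morphism `S₁₂ : A ⋄ B ⋄ B ⟶ A ⋄ B`, the restriction of `1 + (1 1)`. -/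
def fold₁₂ (A B : C) : cosmash₃ A B B ⟶ cosmash A B :=
  cosmashLift (cosmash₃ι A B B ≫ coprod.desc (𝟙 (A ⨿ B)) coprod.inr)
    (by
      have h : coprod.desc (𝟙 (A ⨿ B)) coprod.inr ≫ coprod.desc (𝟙 A) 0 =
          coprod.desc (𝟙 (A ⨿ B)) 0 ≫ coprod.desc (𝟙 A) (0 : B ⟶ A) := by
        ext <;> simp
      rw [Category.assoc, h, cosmash₃ι_12_assoc])
    (by
      have h : coprod.desc (𝟙 (A ⨿ B)) coprod.inr ≫ coprod.desc 0 (𝟙 B) =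
          coprod.map (coprod.desc 0 (𝟙 B)) (𝟙 B) ≫ coprod.desc (𝟙 B) (𝟙 B) := by
        ext <;> simp
      rw [Category.assoc, h, cosmash₃ι_23_assoc])

@[simp]
lemma fold₁₂_ι (A B : C) : fold₁₂ A B ≫ cosmashι A B =
    cosmash₃ι A B B ≫ coprod.desc (𝟙 (A ⨿ B)) coprod.inr :=
  cosmashLift_ι _ _ _

@[simp]
lemma fold₁₂_ι_assoc (A B : C) {Z : C} (q : A ⨿ B ⟶ Z) :
    fold₁₂ A B ≫ cosmashι A B ≫ q = cosmash₃ι A B B ≫ coprod.desc (𝟙 (A ⨿ B)) coprod.inr ≫ q := by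
  rw [← Category.assoc, fold₁₂_ι, Category.assoc]

/-- The conjugation action core of `A` on itself. -/
def conj (A : C) : cosmash A A ⟶ A := cosmashι A A ≫ coprod.desc (𝟙 A) (𝟙 A)

/-- `ψ : A ⋄ X ⟶ X` is the action core associated with some split extension of `A` by `X`. -/
def IsActionCore {A X : C} (ψ : cosmash A X ⟶ X) : Prop :=
  ∃ S : SplitExt X A, ψ ≫ S.k = cosmashι A X ≫ coprod.desc S.s S.k

variable (C) in
/-- Internal crossed modules in a semi-abelian category, in terms of action cores. -/
structure XMod where
  X : C
  A : C
  ψ : cosmash A X ⟶ X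
  bd : X ⟶ A
  isActionCore : IsActionCore ψ
  precrossed : ψ ≫ bd = cosmashMap (𝟙 A) bd ≫ conj A
  peiffer : conj X = cosmashMap bd (𝟙 X) ≫ ψ
  ternary : fold₁₂ A X ≫ ψ = cosmash₃Map (𝟙 A) bd (𝟙 X) ≫ fold₂₁ A X ≫ ψ

namespace XMod

/-- Morphisms of crossed modules: equivariant pairs compatible with the boundary morphisms. -/
@[ext]
structure Hom (M N : XMod C) where
  fX : M.X ⟶ N.X
  fA : M.A ⟶ N.A
  comm : M.bd ≫ fA = fX ≫ N.bd
  equivariant : M.ψ ≫ fX = cosmashMap fA fX ≫ N.ψ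

instance : Category (XMod C) where
  Hom := Hom
  id M := ⟨𝟙 _, 𝟙 _, by simp, by simp [cosmashMap_id]⟩
  comp f g := ⟨f.fX ≫ g.fX, f.fA ≫ g.fA, by
      rw [← Category.assoc, f.comm, Category.assoc, g.comm, Category.assoc], by
      rw [← Category.assoc, f.equivariant, Category.assoc, g.equivariant, cosmashMap_comp,
        Category.assoc]⟩
  id_comp _ := Hom.ext (Category.id_comp _) (Category.id_comp _)
  comp_id _ := Hom.ext (Category.comp_id _) (Category.comp_id _)
  assoc _ _ _ := Hom.ext (Category.assoc _ _ _) (Category.assoc _ _ _)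

variable (C) in
/-- The functor that sends a crossed module `(T, G, ψ, ∂)` to the product `T × G`. -/
def prodFunctor : XMod C ⥤ C where
  obj M := M.X ⨯ M.A
  map f := prod.map f.fX f.fA
  map_id _ := prod.map_id_id
  map_comp _ _ := (prod.map_map _ _ _ _).symm

section Kernel

variable {Y E B : C} (k : Y ⟶ E) (p : E ⟶ B) (zero : k ≫ p = 0)
  (hk : IsLimit (KernelFork.ofι k zero))

/-- The conjugation action core `χ` of `E` on a kernel `k : Y ⟶ E`, with `k χ = (1 k) h`. -/
def kernelCore : cosmash E Y ⟶ Y :=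
  KernelFork.IsLimit.lift' hk (cosmashι E Y ≫ coprod.desc (𝟙 E) k) (by
    have h : coprod.desc (𝟙 E) k ≫ p = coprod.desc (𝟙 E) 0 ≫ p := by
      ext <;> simp [zero]
    rw [Category.assoc, h, cosmashι_left_assoc]) |>.1

lemma kernelCore_comp : kernelCore k p zero hk ≫ k = cosmashι E Y ≫ coprod.desc (𝟙 E) k :=
  (KernelFork.IsLimit.lift' hk _ _).2

/-- The conjugation action core on a kernel comes from the split extension given by the kernel pair
of `p`, its first projection and its diagonal. -/
lemma kernelCore_isActionCore : IsActionCore (kernelCore k p zero hk) := by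
  have := mono_of_isKernel k p zero hk
  have w : pullback.lift (f := p) (g := p) 0 k (by simp [zero]) ≫ pullback.fst p p = 0 := by simp
  have hm : Mono (pullback.lift (f := p) (g := p) 0 k (by simp [zero])) := by
    have : Mono (pullback.lift (f := p) (g := p) 0 k (by simp [zero]) ≫ pullback.snd p p) := by
      rwa [pullback.lift_snd]
    exact mono_of_mono _ (pullback.snd p p)
  refine ⟨⟨pullback p p, pullback.lift 0 k (by simp [zero]), pullback.fst p p,
    pullback.lift (𝟙 E) (𝟙 E) rfl, by simp, w, ⟨?_⟩⟩, ?_⟩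
  · refine KernelFork.IsLimit.ofι' _ w fun {W} g hg => ?_
    have hg' : (g ≫ pullback.snd p p) ≫ p = 0 := by
      rw [Category.assoc, ← pullback.condition, ← Category.assoc, hg, zero_comp]
    obtain ⟨l, hl⟩ := KernelFork.IsLimit.lift' hk _ hg'
    refine ⟨l, ?_⟩
    apply pullback.hom_ext
    · simp [hg]
    · simpa using hl
  · apply pullback.hom_ext
    · have h : coprod.desc (pullback.lift (f := p) (g := p) (𝟙 E) (𝟙 E) rfl)
          (pullback.lift 0 k (by simp [zero])) ≫ pullback.fst p p = coprod.desc (𝟙 E) 0 := by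
        ext <;> simp
      simp only [Category.assoc]
      rw [h, cosmashι_left, w, comp_zero]
    · have h : coprod.desc (pullback.lift (f := p) (g := p) (𝟙 E) (𝟙 E) rfl)
          (pullback.lift 0 k (by simp [zero])) ≫ pullback.snd p p = coprod.desc (𝟙 E) k := by
        ext <;> simp
      simp only [Category.assoc]
      rw [h, pullback.lift_snd, kernelCore_comp]

/-- A kernel `k : Y ⟶ E` with its natural crossed module structure. -/
def ofKernel : XMod C where
  X := Y
  A := E
  ψ := kernelCore k p zero hk
  bd := k
  isActionCore := kernelCore_isActionCore k p zero hk
  precrossed := by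
    rw [kernelCore_comp, conj, cosmashMap_ι_assoc]
    congr 1
    ext <;> simp
  peiffer := by
    have := mono_of_isKernel k p zero hk
    rw [← cancel_mono k, Category.assoc, kernelCore_comp, conj, cosmashMap_ι_assoc,
      Category.assoc]
    congr 1
    ext <;> simp
  ternary := by
    have := mono_of_isKernel k p zero hk
    rw [← cancel_mono k]
    simp only [Category.assoc]
    rw [kernelCore_comp, fold₁₂_ι_assoc, fold₂₁_ι_assoc, cosmash₃Map_ι_assoc]
    congr 1
    ext <;> simp

end Kernel

/-- The kernel part of a split extension, as a crossed module. -/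
def ofSplitExt {X B : C} (S : SplitExt X B) : XMod C :=
  ofKernel S.k S.p S.zero S.isKernel.some

end XMod

end Cosmash

/-! ### Free objects and the Schreier property -/

section Free

variable {D : Type u} [Category.{v} D]

/-- `F` is free with respect to the forgetful functor `U` to sets: it is the value at some set `S`
of a left adjoint of `U`. -/
def IsFree (U : D ⥤ Type w) (F : D) : Prop :=
  ∃ (S : Type w) (η : S → U.obj F), ∀ (M : D) (g : S → U.obj M),
    ∃! f : F ⟶ M, ∀ s, (U.map f : U.obj F → U.obj M) (η s) = g s

/-- The Schreier property: every subobject of a free object is free. -/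
def IsSchreier (U : D ⥤ Type w) : Prop :=
  ∀ ⦃K F : D⦄ (i : K ⟶ F) [Mono i], IsFree U F → IsFree U K

end Free

/-! ### Varieties of algebras -/

/-- A (finitary, one-sorted) variety of algebras: a signature, given as a first-order language
without relation symbols, and a set of identities between terms. -/
structure Variety where
  L : FirstOrder.Language.{u, 0}
  algebraic : L.IsAlgebraic
  identities : Set (L.Term ℕ × L.Term ℕ)

namespace Variety

/-- The algebras of a variety. -/
structure Alg (V : Variety.{u}) where
  carrier : Type u
  [str : V.L.Structure carrier]
  satisfies : ∀ e ∈ V.identities, ∀ x : ℕ → carrier, e.1.realize x = e.2.realize x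

attribute [instance] Alg.str

instance (V : Variety.{u}) : Category V.Alg where
  Hom A B := FirstOrder.Language.Hom V.L A.carrier B.carrier
  id A := FirstOrder.Language.Hom.id V.L A.carrier
  comp f g := g.comp f

/-- The underlying-set functor of a variety. -/
def forget (V : Variety.{u}) : V.Alg ⥤ Type u where
  obj A := A.carrier
  map {A B} f := ↾(FirstOrder.Language.Hom.toFun (L := V.L) (M := A.carrier) (N := B.carrier) f)

/-- A variety is non-trivial if not all of its algebras have at most one element. -/
def NonTrivial (V : Variety.{u}) : Prop := ∃ A : V.Alg, Nontrivial A.carrier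

/-- The forgetful functor of the variety of internal crossed modules in a semi-abelian variety: it
sends `(T, G, ψ, ∂)` to the underlying set of `T × G`. -/
def xmodForget (V : Variety.{u}) [HasZeroMorphisms V.Alg] [SemiAbelian V.Alg] :
    XMod V.Alg ⥤ Type u :=
  XMod.prodFunctor V.Alg ⋙ V.forget

end Variety

end SemiAb

end

open SemiAb

noncomputable section

namespace SemiAb

/-! A crossed module `N` is an internal groupoid: its arrows form the semidirect product of `N.A`
and `N.X`, with the retraction as domain and a codomain morphism extending the boundary. For a split
epimorphism `p` with section `s`, the kernel pair of `p` is a groupoid in which every object `e`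
receives a distinguished arrow from `s (p e)`. A morphism of crossed modules from the kernel of `p`
to `N` therefore amounts to a morphism of split extensions, over a varying base, to the semidirect
product of `N`. Consequently the kernel of `free V (S ⊕ T) ⟶ free V S` is the crossed module free on
two sets (`exists_freeXMod_hom`, `freeXMod_hom_ext`). This yields projectivity, and the objects free
on one set `S` are, up to isomorphism, the `freeXMod V S S`.

The counterexample has infinitely many generators in `A` and a single one in `X`. A one-point set is
a retract of an infinite set, so this object embeds in a free one (`exists_mono_freeXMod`). It is
not free (`not_isFree_freeXMod`): in `freeXMod V S S`, a finite `S` gives too few generators in `A`,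
and an infinite `S` too many in `X`, because an element involves only finitely many generators.

Protomodularity enters through `splitExt_induction` and its consequence `mem_of_ap_eq`, which reduce
statements about elements to kernels and sections. They give generators of `(A + B) ⋄ D`
(`cosmash_coprod_hom_ext`), on which the crossed module axioms identify the conjugation action of
the semidirect product (`kernelCore_eq`). -/

/-- A monomorphism through which a regular epimorphism factors is split. -/
lemma exists_section_of_isRegularEpi {C : Type u} [Category.{v} C] {A I B : C} {f : A ⟶ B}
    [hf : IsRegularEpi f] {e : A ⟶ I} {m : I ⟶ B} [Mono m] (h : e ≫ m = f) :
    ∃ d : B ⟶ I, d ≫ m = 𝟙 B := by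
  subst h
  obtain ⟨r⟩ := hf.regularEpi
  obtain ⟨d, hd⟩ := r.desc' e (by
    rw [← cancel_mono m, Category.assoc, Category.assoc, r.w])
  refine ⟨d, Cofork.IsColimit.hom_ext r.isColimit ?_⟩
  change (e ≫ m) ≫ d ≫ m = (e ≫ m) ≫ 𝟙 B
  rw [← Category.assoc, hd, Category.comp_id]

/-- Objects that are free on the same set are isomorphic. -/
lemma nonempty_iso_of_free {D : Type u} [Category.{v} D] (U : D ⥤ Type w) {S : Type w} {F F' : D}
    {η : S → U.obj F} {η' : S → U.obj F'}
    (h : ∀ (M : D) (g : S → U.obj M),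
      ∃! f : F ⟶ M, ∀ s, (U.map f : U.obj F → U.obj M) (η s) = g s)
    (h' : ∀ (M : D) (g : S → U.obj M),
      ∃! f : F' ⟶ M, ∀ s, (U.map f : U.obj F' → U.obj M) (η' s) = g s) : Nonempty (F ≅ F') := by
  obtain ⟨f, hf, -⟩ := h F' η'
  obtain ⟨g, hg, -⟩ := h' F η
  refine ⟨⟨f, g, (h F η).unique (fun s => ?_) (fun s => ?_),
    (h' F' η').unique (fun s => ?_) (fun s => ?_)⟩⟩
  all_goals simp [hf, hg]

namespace Variety

open FirstOrder FirstOrder.Language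

variable {V : Variety.{u}}

/-! ### Elements, homomorphisms and subalgebras -/

/-- The value of a homomorphism of algebras at an element. -/
def ap {A B : V.Alg} (f : A ⟶ B) (a : A.carrier) : B.carrier :=
  (show A.carrier →[V.L] B.carrier from f) a

lemma hom_ext {A B : V.Alg} {f g : A ⟶ B} (h : ∀ a, ap f a = ap g a) : f = g :=
  FirstOrder.Language.Hom.ext (f := f) (g := g) h

@[simp] lemma ap_id {A : V.Alg} (a : A.carrier) : ap (𝟙 A) a = a := rfl

@[simp] lemma ap_comp {A B D : V.Alg} (f : A ⟶ B) (g : B ⟶ D) (a : A.carrier) :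
    ap (f ≫ g) a = ap g (ap f a) := rfl

lemma ap_funMap {A B : V.Alg} (f : A ⟶ B) {n : ℕ} (c : V.L.Functions n)
    (x : Fin n → A.carrier) :
    ap f (Structure.funMap c x) = Structure.funMap c (fun i => ap f (x i)) :=
  FirstOrder.Language.Hom.map_fun (show A.carrier →[V.L] B.carrier from f) c x

/-- A homomorphism of algebras, from a function that preserves the operations. -/
def mkHom {A B : V.Alg} (f : A.carrier → B.carrier)
    (h : ∀ {n : ℕ} (c : V.L.Functions n) (x : Fin n → A.carrier),
      f (Structure.funMap c x) = Structure.funMap c (fun i => f (x i))) : A ⟶ B :=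
  show A.carrier →[V.L] B.carrier from
    ⟨f, fun c x => h c x, fun r _ => ((V.algebraic _).false r).elim⟩

/-- The preimage of a subalgebra. -/
def preimage {A B : V.Alg} (f : A ⟶ B) (U : V.L.Substructure B.carrier) :
    V.L.Substructure A.carrier :=
  U.comap (show A.carrier →[V.L] B.carrier from f)

@[simp] lemma mem_preimage {A B : V.Alg} {f : A ⟶ B} {U : V.L.Substructure B.carrier}
    {a : A.carrier} : a ∈ preimage f U ↔ ap f a ∈ U := Iff.rfl

/-- The direct image of a subalgebra. -/
def image {A B : V.Alg} (f : A ⟶ B) (U : V.L.Substructure A.carrier) :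
    V.L.Substructure B.carrier :=
  U.map (show A.carrier →[V.L] B.carrier from f)

/-- The subalgebra on which two homomorphisms agree. -/
def equalizer {A B : V.Alg} (f g : A ⟶ B) : V.L.Substructure A.carrier :=
  (show A.carrier →[V.L] B.carrier from f).eqLocus (show A.carrier →[V.L] B.carrier from g)

@[simp] lemma mem_equalizer {A B : V.Alg} {f g : A ⟶ B} {a : A.carrier} :
    a ∈ equalizer f g ↔ ap f a = ap g a := Iff.rfl

/-- A subalgebra, as an algebra. -/
def subAlg {A : V.Alg} (U : V.L.Substructure A.carrier) : V.Alg where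
  carrier := U
  satisfies e he x := by
    apply Subtype.ext
    have h := A.satisfies e he (fun i => (x i : A.carrier))
    have h₁ (t : V.L.Term ℕ) : ((t.realize x : U) : A.carrier) =
        t.realize (fun i => (x i : A.carrier)) :=
      (HomClass.realize_term U.subtype).symm
    rw [h₁, h₁, h]

/-- The inclusion of a subalgebra. -/
def incl {A : V.Alg} (U : V.L.Substructure A.carrier) : subAlg U ⟶ A :=
  mkHom (A := subAlg U) (fun a : U => (a : A.carrier)) (fun _ _ => rfl)

lemma incl_injective {A : V.Alg} (U : V.L.Substructure A.carrier) :
    Function.Injective (ap (incl U)) := Subtype.coe_injective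

lemma ap_incl_mem {A : V.Alg} (U : V.L.Substructure A.carrier) (a : (subAlg U).carrier) :
    ap (incl U) a ∈ U := Subtype.property (p := (· ∈ U)) a

lemma exists_ap_incl {A : V.Alg} {U : V.L.Substructure A.carrier} {a : A.carrier} (h : a ∈ U) :
    ∃ b, ap (incl U) b = a := ⟨(⟨a, h⟩ : U), rfl⟩

lemma exists_lift_of_injective {A B D : V.Alg} (m : B ⟶ D) (hm : Function.Injective (ap m))
    (f : A ⟶ D) (h : ∀ a, ∃ b, ap m b = ap f a) : ∃ g : A ⟶ B, g ≫ m = f := by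
  choose g hg using h
  refine ⟨mkHom g fun c x => hm ?_, hom_ext fun a => hg a⟩
  rw [hg, ap_funMap, ap_funMap]
  simp only [hg]

lemma exists_desc_of_surjective {A B D : V.Alg} (q : A ⟶ B) (hq : Function.Surjective (ap q))
    (f : A ⟶ D) (h : ∀ a a', ap q a = ap q a' → ap f a = ap f a') : ∃ g : B ⟶ D, q ≫ g = f := by
  choose s hs using hq
  refine ⟨mkHom (fun b => ap f (s b)) fun c x => ?_, hom_ext fun a => h _ _ (hs _)⟩
  rw [← ap_funMap]
  apply h
  rw [hs, ap_funMap]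
  simp only [hs]

/-- Surjections are orthogonal to injections; images thereby inherit structure from both sides. -/
lemma exists_fill {A B D E : V.Alg} (e : A ⟶ B) (he : Function.Surjective (ap e)) (m : D ⟶ E)
    (hm : Function.Injective (ap m)) (f : A ⟶ D) (g : B ⟶ E) (h : e ≫ g = f ≫ m) :
    ∃ d : B ⟶ D, d ≫ m = g ∧ e ≫ d = f := by
  obtain ⟨d, hd⟩ := exists_lift_of_injective m hm g fun b => by
    obtain ⟨a, rfl⟩ := he b
    exact ⟨ap f a, by rw [← ap_comp, ← ap_comp, h]⟩
  refine ⟨d, hd, hom_ext fun a => hm ?_⟩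
  rw [← ap_comp, ← ap_comp, Category.assoc, hd, h]

lemma exists_image {A B : V.Alg} (f : A ⟶ B) : ∃ (I : V.Alg) (e : A ⟶ I) (m : I ⟶ B),
    Function.Surjective (ap e) ∧ Function.Injective (ap m) ∧ e ≫ m = f := by
  obtain ⟨e, he⟩ := exists_lift_of_injective (incl (image f ⊤)) (incl_injective _) f
    fun a => exists_ap_incl ⟨a, trivial, rfl⟩
  refine ⟨_, e, incl (image f ⊤), fun b => ?_, incl_injective _, he⟩
  obtain ⟨a, -, ha⟩ := ap_incl_mem _ b
  refine ⟨a, incl_injective _ ?_⟩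
  rw [← ap_comp, he]
  exact ha

lemma bijective_of_isIso {A B : V.Alg} (f : A ⟶ B) [IsIso f] : Function.Bijective (ap f) := by
  refine Function.bijective_iff_has_inverse.2 ⟨ap (inv f), fun a => ?_, fun b => ?_⟩
  · rw [← ap_comp, IsIso.hom_inv_id, ap_id]
  · rw [← ap_comp, IsIso.inv_hom_id, ap_id]

lemma mono_of_injective {A B : V.Alg} (f : A ⟶ B) (h : Function.Injective (ap f)) : Mono f where
  right_cancellation g g' e := hom_ext fun a => h <| by rw [← ap_comp, e, ap_comp]

lemma surjective_of_isRegularEpi {A B : V.Alg} (f : A ⟶ B) [IsRegularEpi f] :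
    Function.Surjective (ap f) := by
  obtain ⟨I, e, m, he, hm, rfl⟩ := exists_image f
  have := mono_of_injective m hm
  obtain ⟨d, h⟩ := exists_section_of_isRegularEpi (e := e) (m := m) rfl
  intro b
  obtain ⟨a, ha⟩ := he (ap d b)
  exact ⟨a, by rw [ap_comp, ha, ← ap_comp, h, ap_id]⟩

/-! ### Free algebras -/

section FreeAlgebra

variable (V) in
/-- Two terms are equivalent if they have the same values in all algebras. -/
def termSetoid (S : Type u) : Setoid (V.L.Term S) where
  r t t' := ∀ (A : V.Alg) (x : S → A.carrier), t.realize x = t'.realize x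
  iseqv := ⟨fun _ _ _ => rfl, fun h A x => (h A x).symm, fun h h' A x => (h A x).trans (h' A x)⟩

/-- The algebra of terms. -/
instance termStructure (S : Type u) : V.L.Prestructure (termSetoid V S) where
  toStructure :=
    { funMap := fun c ts => Term.func c ts
      RelMap := fun r _ => ((V.algebraic _).false r).elim }
  fun_equiv x y h A v := by
    change Structure.funMap _ (fun i => (x i).realize v) =
      Structure.funMap _ (fun i => (y i).realize v)
    congr 1
    ext i
    exact h i A v
  rel_equiv {_ r} := ((V.algebraic _).false r).elim

/-- Because evaluation in the term algebra is substitution, an identity of the variety evaluated at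
terms yields two terms with equal values in all algebras, so the quotient satisfies it. -/
lemma realize_term_eq_subst {S : Type u} {T : Type*} (t : V.L.Term T) (x : T → V.L.Term S) :
    @Term.realize V.L _ (termStructure S).toStructure _ x t = t.subst x := by
  induction t with
  | var => rfl
  | func c ts ih =>
    change Term.func c _ = Term.func c _
    congr 1
    ext i
    exact ih i

variable (V) in
/-- The free algebra on a set. -/
def free (S : Type u) : V.Alg where
  carrier := Quotient (termSetoid V S)
  str := quotientStructure
  satisfies e he x := by
    obtain ⟨y, rfl⟩ : ∃ y : ℕ → V.L.Term S, (fun i => Quotient.mk (termSetoid V S) (y i)) = x :=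
      ⟨fun i => (x i).out, funext fun i => Quotient.out_eq _⟩
    rw [Term.realize_quotient_mk', Term.realize_quotient_mk']
    apply Quotient.sound
    intro A v
    rw [realize_term_eq_subst, realize_term_eq_subst, Term.realize_subst, Term.realize_subst]
    exact A.satisfies e he _

/-- The generators of a free algebra. -/
def gen {S : Type u} (i : S) : (free V S).carrier :=
  Quotient.mk (termSetoid V S) (Term.var i)

lemma exists_term {S : Type u} (z : (free V S).carrier) :
    ∃ t : V.L.Term S, t.realize (gen (V := V)) = z := by
  obtain ⟨t, rfl⟩ := Quotient.exists_rep z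
  refine ⟨t, (Term.realize_quotient_mk' (termSetoid V S) t _).trans ?_⟩
  rw [realize_term_eq_subst]
  congr 1
  induction t with
  | var => rfl
  | func c ts ih =>
    change Term.func c _ = Term.func c _
    congr 1
    ext i
    exact ih i

/-- The homomorphism on a free algebra with given values at the generators. -/
def lift {S : Type u} {A : V.Alg} (x : S → A.carrier) : free V S ⟶ A :=
  mkHom (A := free V S) (Quotient.lift (fun t : V.L.Term S => t.realize x) fun _ _ h => h A x)
    fun {n} c y => by
      obtain ⟨t, rfl⟩ : ∃ t : Fin n → V.L.Term S,
          (fun i => Quotient.mk (termSetoid V S) (t i)) = y :=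
        ⟨fun i => (y i).out, funext fun i => Quotient.out_eq _⟩
      refine (congrArg _ (funMap_quotient_mk' (termSetoid V S) c t)).trans ?_
      rfl

@[simp] lemma ap_lift_gen {S : Type u} {A : V.Alg} (x : S → A.carrier) (i : S) :
    ap (lift x) (gen i) = x i := rfl

lemma free_induction {S : Type u} (U : V.L.Substructure (free V S).carrier)
    (h : ∀ i, gen i ∈ U) (z : (free V S).carrier) : z ∈ U := by
  obtain ⟨t, rfl⟩ := exists_term z
  induction t with
  | var i => exact h i
  | func c ts ih => exact U.fun_mem c _ ih

lemma free_hom_ext {S : Type u} {A : V.Alg} {f g : free V S ⟶ A}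
    (h : ∀ i, ap f (gen i) = ap g (gen i)) : f = g :=
  hom_ext fun z => free_induction (equalizer f g) h z

/-- This is where finitarity enters: a term contains finitely many variables. -/
lemma exists_finite_support {S : Type u} (z : (free V S).carrier) :
    ∃ s : Set S, s.Finite ∧ ∀ (A : V.Alg) (f g : free V S ⟶ A),
      (∀ i ∈ s, ap f (gen i) = ap g (gen i)) → ap f z = ap g z := by
  obtain ⟨t, rfl⟩ := exists_term z
  induction t with
  | var i => exact ⟨{i}, Set.finite_singleton i, fun A f g h => h i rfl⟩
  | func c ts ih =>
    choose s hs h using ih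
    refine ⟨⋃ i, s i, Set.finite_iUnion hs, fun A f g hfg => ?_⟩
    change ap f (Structure.funMap c _) = ap g (Structure.funMap c _)
    rw [ap_funMap, ap_funMap]
    congr 1
    ext i
    exact h i A f g fun j hj => hfg j (Set.mem_iUnion_of_mem i hj)

/-- An element of an algebra, as a homomorphism on the free algebra on one generator. -/
def pt {A : V.Alg} (a : A.carrier) : free V PUnit ⟶ A := lift fun _ => a

@[simp] lemma ap_pt {A : V.Alg} (a : A.carrier) (i : PUnit) : ap (pt a) (gen i) = a := rfl

lemma pt_comp {A B : V.Alg} (a : A.carrier) (f : A ⟶ B) : pt a ≫ f = pt (ap f a) :=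
  free_hom_ext fun _ => rfl

/-- Elements are morphisms from the free algebra on one generator, so cancellation applies to them.
-/
lemma injective_of_mono {A B : V.Alg} (f : A ⟶ B) [Mono f] : Function.Injective (ap f) := by
  intro a a' h
  have : pt a = pt a' := by rw [← cancel_mono f, pt_comp, pt_comp, h]
  rw [← ap_pt a PUnit.unit, this, ap_pt]

lemma isRegularProjective_free (S : Type u) : IsRegularProjective (free V S) := by
  intro X Y e _ f
  choose x hx using fun i => surjective_of_isRegularEpi e (ap f (gen i))
  exact ⟨lift x, free_hom_ext fun i => hx i⟩

end FreeAlgebra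

/-! ### Zero elements and kernels -/

section Zero

variable [HasZeroMorphisms V.Alg]

/-- The zero element of an algebra of a pointed variety. -/
def zeroElt (A : V.Alg) : A.carrier := ap (0 : free V PUnit ⟶ A) (gen PUnit.unit)

@[simp] lemma ap_zero {A B : V.Alg} (a : A.carrier) : ap (0 : A ⟶ B) a = zeroElt B := by
  rw [zeroElt, ← comp_zero (f := pt a), ap_comp, ap_pt]

@[simp] lemma ap_zeroElt {A B : V.Alg} (f : A ⟶ B) : ap f (zeroElt A) = zeroElt B := by
  rw [zeroElt, ← ap_comp, zero_comp, ap_zero]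

lemma zeroElt_mem {A : V.Alg} (U : V.L.Substructure A.carrier) : zeroElt A ∈ U := by
  rw [← ap_zeroElt (incl U)]
  exact ap_incl_mem U _

lemma exists_of_isKernel {X E B : V.Alg} {k : X ⟶ E} {p : E ⟶ B} {zero : k ≫ p = 0}
    (hk : IsLimit (KernelFork.ofι k zero)) {e : E.carrier} (he : ap p e = zeroElt B) :
    ∃ x, ap k x = e := by
  obtain ⟨l, hl⟩ := KernelFork.IsLimit.lift' hk (pt e)
    (free_hom_ext fun i => by rw [ap_comp, ap_pt, he, ap_zero])
  refine ⟨ap l (gen PUnit.unit), ?_⟩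
  rw [← ap_comp]
  exact congrArg (fun f => ap f (gen PUnit.unit)) hl

lemma injective_of_isKernel {X E B : V.Alg} {k : X ⟶ E} {p : E ⟶ B} {zero : k ≫ p = 0}
    (hk : IsLimit (KernelFork.ofι k zero)) : Function.Injective (ap k) :=
  have := mono_of_isKernel k p zero hk
  injective_of_mono k

lemma isKernel_of_injective {X E B : V.Alg} {k : X ⟶ E} {p : E ⟶ B} (zero : k ≫ p = 0)
    (hi : Function.Injective (ap k)) (h : ∀ e, ap p e = zeroElt B → ∃ x, ap k x = e) :
    Nonempty (IsLimit (KernelFork.ofι k zero)) := by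
  have := mono_of_injective k hi
  refine ⟨KernelFork.IsLimit.ofι' k zero fun {W} g hg => ?_⟩
  have h' := exists_lift_of_injective k hi g fun a => h _ (by rw [← ap_comp, hg, ap_zero])
  exact ⟨h'.choose, h'.choose_spec⟩

lemma gen_ne_zeroElt (hV : V.NonTrivial) {S : Type u} (i : S) :
    gen i ≠ zeroElt (free V S) := by
  obtain ⟨A, hA⟩ := hV
  obtain ⟨a, ha⟩ := exists_ne (zeroElt A)
  intro h
  exact ha (by rw [← ap_zeroElt (lift fun _ : S => a), ← h, ap_lift_gen])

/-- In a non-trivial variety, a free algebra on an infinite set is not finitely generated. -/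
lemma not_surjective_of_finite (hV : V.NonTrivial) {S T : Type u} [Finite S] [Infinite T]
    (f : free V S ⟶ free V T) : ¬ Function.Surjective (ap f) := by
  classical
  intro hf
  choose s hs h using fun i : S => exists_finite_support (ap f (gen i))
  -- No image of a generator involves `t`. Killing `gen t` and fixing the other generators thus
  -- leaves `f` unchanged, and surjectivity of `f` would force `gen t` to be zero.
  obtain ⟨t, ht⟩ := (Set.finite_iUnion hs).exists_notMem
  let e : free V T ⟶ free V T := lift fun j => if j = t then zeroElt _ else gen j
  have he : f ≫ e = f := free_hom_ext fun i => by
    refine h i _ e (𝟙 _) fun j hj => ?_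
    have : j ≠ t := fun hjt => ht (Set.mem_iUnion_of_mem i (hjt ▸ hj))
    simp [e, this]
  obtain ⟨z, hz⟩ := hf (gen t)
  apply gen_ne_zeroElt hV t
  rw [← hz, ← he, ap_comp, hz]
  simp [e]

variable (V) in
/-- The homomorphism that sends the generators in the second set to zero. -/
def proj (S T : Type u) : free V (S ⊕ T) ⟶ free V S :=
  lift (Sum.elim gen fun _ => zeroElt _)

variable (V) in
/-- The inclusion of the free algebra on the first set. -/
def sect (S T : Type u) : free V S ⟶ free V (S ⊕ T) := lift fun s => gen (Sum.inl s)

lemma sect_proj (S T : Type u) : sect V S T ≫ proj V S T = 𝟙 _ := free_hom_ext fun _ => rfl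

end Zero

/-! ### Protomodularity in terms of elements -/

section Protomodular

variable [HasZeroMorphisms V.Alg] [SemiAbelian V.Alg]

/-- In a split extension, the kernel and the section generate the middle algebra. -/
lemma splitExt_induction {X B : V.Alg} (S : SplitExt X B) (U : V.L.Substructure S.E.carrier)
    (hk : ∀ x, ap S.k x ∈ U) (hs : ∀ b, ap S.s b ∈ U) (e : S.E.carrier) : e ∈ U := by
  obtain ⟨k, hk⟩ := exists_lift_of_injective (incl U) (incl_injective U) S.k
    fun x => exists_ap_incl (hk x)
  obtain ⟨s, hs⟩ := exists_lift_of_injective (incl U) (incl_injective U) S.s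
    fun x => exists_ap_incl (hs x)
  have zero : k ≫ incl U ≫ S.p = 0 := by rw [← Category.assoc, hk, S.zero]
  have hker : Nonempty (IsLimit (KernelFork.ofι k zero)) := by
    refine isKernel_of_injective zero (fun x x' h => ?_) fun a ha => ?_
    · apply injective_of_isKernel S.isKernel.some
      rw [← hk, ap_comp, h, ap_comp]
    · obtain ⟨x, hx⟩ := exists_of_isKernel S.isKernel.some ha
      exact ⟨x, incl_injective U (by rw [← ap_comp, hk]; exact hx)⟩
  -- The Split Short Five Lemma, with identities on kernel and base, makes the inclusion of `U` an
  -- isomorphism.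
  have := SemiAbelian.protomodular ⟨subAlg U, k, incl U ≫ S.p, s, by
    rw [← Category.assoc, hs, S.splitting], zero, hker⟩ S (𝟙 X) (incl U) (𝟙 B)
    (by rw [hk, Category.id_comp]) (by rw [Category.comp_id]) (by rw [hs, Category.id_comp])
    inferInstance inferInstance
  obtain ⟨a, rfl⟩ := (bijective_of_isIso (incl U)).2 e
  exact ap_incl_mem U a

/-- If the subalgebra `U` contains the elements of the kernel of `π` that lie in `N`, then, in `N`,
it is saturated for the kernel pair of `π`. -/
lemma mem_of_ap_eq {A B : V.Alg} (π : A ⟶ B) (U N : V.L.Substructure A.carrier)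
    (hU : ∀ a ∈ N, ap π a = zeroElt B → a ∈ U) {x y : A.carrier} (hx : x ∈ N) (hy : y ∈ N)
    (hyU : y ∈ U) (h : ap π x = ap π y) : x ∈ U := by
  -- The two generators name `x` and `y`, and `p` identifies them, with section `s` onto the second.
  -- Elements of the kernel of `p` land in `N` and in the kernel of `π`, hence in `U`; the section
  -- lands in `U` because `y` does. Together they generate, so `x` lies in `U` too.
  let f : free V (PUnit.{u + 1} ⊕ PUnit.{u + 1}) ⟶ A := lift (Sum.elim (fun _ => x) fun _ => y)
  let p : free V (PUnit.{u + 1} ⊕ PUnit.{u + 1}) ⟶ free V PUnit.{u + 1} :=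
    lift fun _ => gen PUnit.unit
  let s : free V PUnit.{u + 1} ⟶ free V (PUnit.{u + 1} ⊕ PUnit.{u + 1}) :=
    lift fun _ => gen (Sum.inr PUnit.unit)
  have hfN (z) : z ∈ preimage f N := free_induction _ (by rintro (_ | _) <;> assumption) z
  have hfp : f ≫ π = p ≫ pt (ap π y) := free_hom_ext (by rintro (_ | _) <;> [exact h; rfl])
  exact splitExt_induction ⟨_, kernel.ι p, p, s, free_hom_ext fun _ => rfl, kernel.condition p,
    ⟨kernelIsKernel p⟩⟩ (preimage f U)
    (fun z => hU _ (hfN _) (by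
      change ap (kernel.ι p ≫ f ≫ π) z = _
      rw [hfp, kernel.condition_assoc, zero_comp, ap_zero]))
    (fun z => free_induction (preimage s (preimage f U)) (fun _ => hyU) z)
    (gen (Sum.inl PUnit.unit))

/-- A congruence is determined by its zero class, so inclusion of kernels implies inclusion of
kernel pairs. -/
lemma ap_eq_of_kernel_le {A B D : V.Alg} (q : A ⟶ B) (r : A ⟶ D)
    (h : ∀ a, ap q a = zeroElt B → ap r a = zeroElt D) {x y : A.carrier}
    (hxy : ap q x = ap q y) : ap r x = ap r y := by
  let f : free V (PUnit.{u + 1} ⊕ PUnit.{u + 1}) ⟶ A := lift (Sum.elim (fun _ => x) fun _ => y)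
  let p : free V (PUnit.{u + 1} ⊕ PUnit.{u + 1}) ⟶ free V PUnit.{u + 1} :=
    lift fun _ => gen PUnit.unit
  have hp : f ≫ q = p ≫ pt (ap q y) := free_hom_ext (by rintro (_ | _) <;> [exact hxy; rfl])
  refine mem_of_ap_eq p (equalizer (f ≫ r) (p ≫ pt (ap r y))) ⊤ (fun a _ ha => ?_)
    (x := gen (Sum.inl PUnit.unit)) (y := gen (Sum.inr PUnit.unit)) trivial trivial rfl rfl
  rw [mem_equalizer, ap_comp, ap_comp, ha, ap_zeroElt]
  apply h
  rw [← ap_comp, hp, ap_comp, ha, ap_zeroElt]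

lemma coprod_induction {A B : V.Alg} (U : V.L.Substructure (A ⨿ B : V.Alg).carrier)
    (h₁ : ∀ a, ap (coprod.inl : A ⟶ A ⨿ B) a ∈ U) (h₂ : ∀ b, ap (coprod.inr : B ⟶ A ⨿ B) b ∈ U)
    (z : (A ⨿ B : V.Alg).carrier) : z ∈ U := by
  obtain ⟨i, hi⟩ := exists_lift_of_injective (incl U) (incl_injective U) coprod.inl
    fun a => exists_ap_incl (h₁ a)
  obtain ⟨j, hj⟩ := exists_lift_of_injective (incl U) (incl_injective U) coprod.inr
    fun a => exists_ap_incl (h₂ a)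
  have h : coprod.desc i j ≫ incl U = 𝟙 (A ⨿ B) := by
    apply coprod.hom_ext
    · rw [coprod.inl_desc_assoc, hi, Category.comp_id]
    · rw [coprod.inr_desc_assoc, hj, Category.comp_id]
  rw [← ap_id z, ← h, ap_comp]
  exact ap_incl_mem U _

lemma exists_cosmash {A B : V.Alg} {z : (A ⨿ B : V.Alg).carrier}
    (h₁ : ap (coprod.desc (𝟙 A) 0) z = zeroElt A) (h₂ : ap (coprod.desc 0 (𝟙 B)) z = zeroElt B) :
    ∃ c, ap (cosmashι A B) c = z := by
  refine ⟨ap (cosmashLift (pt z) ?_ ?_) (gen PUnit.unit), ?_⟩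
  · rw [pt_comp, h₁]; exact free_hom_ext fun _ => by rw [ap_pt, ap_zero]
  · rw [pt_comp, h₂]; exact free_hom_ext fun _ => by rw [ap_pt, ap_zero]
  · rw [← ap_comp, cosmashLift_ι, ap_pt]

lemma exists_cosmash₃ {A B D : V.Alg} {z : ((A ⨿ B) ⨿ D : V.Alg).carrier}
    (h₁ : ap (coprod.desc (𝟙 (A ⨿ B)) 0) z = zeroElt _)
    (h₂ : ap (coprod.map (coprod.desc (𝟙 A) 0) (𝟙 D)) z = zeroElt _)
    (h₃ : ap (coprod.map (coprod.desc 0 (𝟙 B)) (𝟙 D)) z = zeroElt _) :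
    ∃ c, ap (cosmash₃ι A B D) c = z := by
  refine exists_of_isKernel (zero := kernel.condition _) (kernelIsKernel (sigma₃ A B D)) ?_
  have h : pt z ≫ sigma₃ A B D = 0 := by
    apply Limits.prod.hom_ext
    · rw [sigma₃, Category.assoc, prod.lift_fst, pt_comp, h₁]
      exact free_hom_ext fun _ => by simp
    · rw [sigma₃, Category.assoc, prod.lift_snd]
      apply Limits.prod.hom_ext
      · rw [Category.assoc, Category.assoc, prod.lift_fst, pt_comp, h₂]
        exact free_hom_ext fun _ => by simp
      · rw [Category.assoc, Category.assoc, prod.lift_snd, pt_comp, h₃]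
        exact free_hom_ext fun _ => by simp
  rw [← ap_pt z PUnit.unit, ← ap_comp, h, ap_zero]

lemma ap_cosmashι_left {A B : V.Alg} (c : (cosmash A B).carrier) :
    ap (coprod.desc (𝟙 A) 0) (ap (cosmashι A B) c) = zeroElt A := by
  rw [← ap_comp, cosmashι_left, ap_zero]

lemma ap_cosmashι_right {A B : V.Alg} (c : (cosmash A B).carrier) :
    ap (coprod.desc 0 (𝟙 B)) (ap (cosmashι A B) c) = zeroElt B := by
  rw [← ap_comp, cosmashι_right, ap_zero]

/-! ### Semidirect products -/

lemma desc_surjective {X B : V.Alg} (S : SplitExt X B) :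
    Function.Surjective (ap (coprod.desc S.s S.k)) := fun e => by
  obtain ⟨z, -, hz⟩ := splitExt_induction S (image (coprod.desc S.s S.k) ⊤)
    (fun x => ⟨ap coprod.inr x, trivial, by
      change ap _ _ = _; rw [← ap_comp, coprod.inr_desc]⟩)
    (fun x => ⟨ap coprod.inl x, trivial, by
      change ap _ _ = _; rw [← ap_comp, coprod.inl_desc]⟩) e
  exact ⟨z, hz⟩

/-- The elements of the kernel of `A + X ⟶ A` come from the cosmash product and from `X`. -/
lemma coprod_kernel_induction {A X : V.Alg} (U : V.L.Substructure (A ⨿ X : V.Alg).carrier)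
    (h₁ : ∀ c, ap (cosmashι A X) c ∈ U) (h₂ : ∀ x, ap (coprod.inr : X ⟶ A ⨿ X) x ∈ U)
    (z : (A ⨿ X : V.Alg).carrier) (hz : ap (coprod.desc (𝟙 A) 0) z = zeroElt A) : z ∈ U := by
  refine mem_of_ap_eq (coprod.desc 0 (𝟙 X)) U (equalizer (coprod.desc (𝟙 A) 0) 0) ?_
    (y := ap coprod.inr (ap (coprod.desc 0 (𝟙 X)) z)) ?_ ?_ (h₂ _) ?_
  · intro a ha ha'
    obtain ⟨c, rfl⟩ := exists_cosmash (by simpa using ha) ha'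
    exact h₁ c
  · simpa using hz
  · rw [mem_equalizer, ← ap_comp, coprod.inr_desc]
    simp
  · rw [← ap_comp coprod.inr, coprod.inr_desc, ap_id]

/-- The universal property of a semidirect product. -/
lemma exists_splitExt_desc {X A W : V.Alg} (S : SplitExt X A) {ψ : cosmash A X ⟶ X}
    (hψ : ψ ≫ S.k = cosmashι A X ≫ coprod.desc S.s S.k) (f : A ⟶ W) (g : X ⟶ W)
    (h : cosmashι A X ≫ coprod.desc f g = ψ ≫ g) : ∃ l : S.E ⟶ W, S.s ≫ l = f ∧ S.k ≫ l = g := by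
  have key (z : (A ⨿ X : V.Alg).carrier) (hz : ap (coprod.desc (𝟙 A) 0) z = zeroElt A) :
      ∃ x, ap S.k x = ap (coprod.desc S.s S.k) z ∧ ap g x = ap (coprod.desc f g) z := by
    -- `U` consists of the elements whose image in `S.E` comes from some `x` in the kernel with the
    -- value that `g` prescribes. It is a subalgebra, so it suffices to test the cosmash product,
    -- where `ψ` supplies `x`, and `X` itself.
    let U : V.L.Substructure (A ⨿ X : V.Alg).carrier :=
      { carrier := {z | ∃ x, ap S.k x = ap (coprod.desc S.s S.k) z ∧
          ap g x = ap (coprod.desc f g) z}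
        fun_mem := fun c y hy => by
          choose x hx hx' using hy
          refine ⟨Structure.funMap c x, ?_, ?_⟩
          · rw [ap_funMap, ap_funMap]; simp only [hx]
          · rw [ap_funMap, ap_funMap]; simp only [hx'] }
    refine coprod_kernel_induction U (fun c => ⟨ap ψ c, ?_, ?_⟩) (fun x => ⟨x, ?_, ?_⟩) z hz
    · rw [← ap_comp, hψ, ap_comp]
    · rw [← ap_comp, ← h, ap_comp]
    · rw [← ap_comp, coprod.inr_desc]
    · rw [← ap_comp, coprod.inr_desc]
  -- Since `S.E` is a quotient of `A + X`, only the kernel of the quotient map has to be checked;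
  -- there `key` gives an `x` that must be zero.
  obtain ⟨l, hl⟩ := exists_desc_of_surjective (coprod.desc S.s S.k) (desc_surjective S)
    (coprod.desc f g) fun a a' => ap_eq_of_kernel_le _ _ fun z hz => by
      have hp : coprod.desc S.s S.k ≫ S.p = coprod.desc (𝟙 A) 0 := by
        apply coprod.hom_ext
        · rw [coprod.inl_desc_assoc, coprod.inl_desc, S.splitting]
        · rw [coprod.inr_desc_assoc, coprod.inr_desc, S.zero]
      obtain ⟨x, hx, hx'⟩ := key z (by rw [← hp, ap_comp, hz, ap_zeroElt])
      have : x = zeroElt X := injective_of_isKernel S.isKernel.some (by rw [hx, hz, ap_zeroElt])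
      rw [← hx', this, ap_zeroElt]
  refine ⟨l, ?_, ?_⟩
  · rw [← coprod.inl_desc S.s S.k, Category.assoc, hl, coprod.inl_desc]
  · rw [← coprod.inr_desc S.s S.k, Category.assoc, hl, coprod.inr_desc]

lemma splitExt_hom_ext {X A W : V.Alg} (S : SplitExt X A) {f g : S.E ⟶ W}
    (hs : S.s ≫ f = S.s ≫ g) (hk : S.k ≫ f = S.k ≫ g) : f = g :=
  hom_ext fun e => splitExt_induction S (equalizer f g)
    (fun x => by rw [mem_equalizer, ← ap_comp, hk, ap_comp])
    (fun x => by rw [mem_equalizer, ← ap_comp, hs, ap_comp]) e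

/-! ### Generation of cosmash products -/

lemma cosmashι_injective (A B : V.Alg) : Function.Injective (ap (cosmashι A B)) :=
  injective_of_mono _

lemma coprod_map_surjective {A A' B B' : V.Alg} {f : A ⟶ A'} {g : B ⟶ B'}
    (hf : Function.Surjective (ap f)) (hg : Function.Surjective (ap g)) :
    Function.Surjective (ap (coprod.map f g)) := fun z => by
  obtain ⟨y, -, hy⟩ := coprod_induction (image (coprod.map f g) ⊤)
    (fun x => by
      obtain ⟨a, rfl⟩ := hf x
      refine ⟨ap coprod.inl a, trivial, ?_⟩
      change ap _ _ = _
      rw [← ap_comp, coprod.inl_map, ap_comp])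
    (fun x => by
      obtain ⟨a, rfl⟩ := hg x
      refine ⟨ap coprod.inr a, trivial, ?_⟩
      change ap _ _ = _
      rw [← ap_comp, coprod.inr_map, ap_comp]) z
  exact ⟨y, hy⟩

/-- A preimage in `A + B` of an element of `A' ⋄ B'` need not lie in `A ⋄ B`: its components merely
lie in the kernels of `f` and `g`. They are corrected to zero one after the other without changing
the image. -/
lemma cosmashMap_surjective {A A' B B' : V.Alg} {f : A ⟶ A'} {g : B ⟶ B'}
    (hf : Function.Surjective (ap f)) (hg : Function.Surjective (ap g)) :
    Function.Surjective (ap (cosmashMap f g)) := fun c => by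
  have e₁ : coprod.map f g ≫ coprod.desc (𝟙 A') 0 = coprod.desc (𝟙 A) 0 ≫ f := by
    apply coprod.hom_ext <;> simp
  have e₂ : coprod.map f g ≫ coprod.desc 0 (𝟙 B') = coprod.desc 0 (𝟙 B) ≫ g := by
    apply coprod.hom_ext <;> simp
  obtain ⟨z, hz⟩ := coprod_map_surjective hf hg (ap (cosmashι A' B') c)
  have hz₁ : ap f (ap (coprod.desc (𝟙 A) 0) z) = zeroElt _ := by
    rw [← ap_comp, ← e₁, ap_comp, hz, ap_cosmashι_left]
  have hz₂ : ap g (ap (coprod.desc 0 (𝟙 B)) z) = zeroElt _ := by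
    rw [← ap_comp, ← e₂, ap_comp, hz, ap_cosmashι_right]
  -- The comparison element is the `A`-component of `z`, which `coprod.map f g` sends to zero.
  obtain ⟨z', hz', hz''⟩ : ap (coprod.map f g) z ∈
      image (coprod.map f g) (equalizer (coprod.desc (𝟙 A) 0) 0) := by
    refine mem_of_ap_eq (coprod.desc (𝟙 A) 0) (preimage (coprod.map f g) (image (coprod.map f g)
      (equalizer (coprod.desc (𝟙 A) 0) 0))) ⊤
      (y := ap coprod.inl (ap (coprod.desc (𝟙 A) 0) z)) (fun a _ ha => ⟨a, ?_, rfl⟩) trivial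
      trivial ?_ ?_
    · simpa using ha
    · rw [mem_preimage, ← ap_comp, coprod.inl_map, ap_comp, hz₁, ap_zeroElt]
      exact zeroElt_mem _
    · rw [← ap_comp coprod.inl, coprod.inl_desc, ap_id]
  replace hz' : ap (coprod.desc (𝟙 A) 0) z' = zeroElt _ := by simpa using hz'
  replace hz'' : ap (coprod.map f g) z' = ap (cosmashι A' B') c := hz''.trans hz
  have hz₃ : ap g (ap (coprod.desc 0 (𝟙 B)) z') = zeroElt _ := by
    rw [← ap_comp, ← e₂, ap_comp, hz'', ap_cosmashι_right]
  -- The second correction stays inside the kernel of `A + B ⟶ A`, so the first is not undone.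
  obtain ⟨d, -, hd⟩ : ap (coprod.map f g) z' ∈ image (cosmashι A B ≫ coprod.map f g) ⊤ := by
    refine mem_of_ap_eq (coprod.desc 0 (𝟙 B)) (preimage (coprod.map f g)
      (image (cosmashι A B ≫ coprod.map f g) ⊤)) (equalizer (coprod.desc (𝟙 A) 0) 0)
      (y := ap coprod.inr (ap (coprod.desc 0 (𝟙 B)) z')) (fun a ha ha' => ?_) ?_ ?_ ?_ ?_
    · obtain ⟨d, rfl⟩ := exists_cosmash (by simpa using ha) ha'
      exact ⟨d, trivial, rfl⟩
    · simpa using hz'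
    · rw [mem_equalizer, ← ap_comp coprod.inr, coprod.inr_desc]
      simp
    · rw [mem_preimage, ← ap_comp, coprod.inr_map, ap_comp, hz₃, ap_zeroElt]
      exact zeroElt_mem _
    · rw [← ap_comp coprod.inr, coprod.inr_desc, ap_id]
  refine ⟨d, cosmashι_injective _ _ ?_⟩
  rw [← ap_comp, cosmashMap_ι, ← hz'']
  exact hd

/-- The inclusion of `A ⋄ B ⋄ D` in `(A + B) ⋄ D`. -/
def cosmash₃Incl (A B D : V.Alg) : cosmash₃ A B D ⟶ cosmash (A ⨿ B) D :=
  cosmashLift (cosmash₃ι A B D) (cosmash₃ι_12 A B D) (by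
    have h : coprod.map (coprod.desc 0 (𝟙 B)) (𝟙 D) ≫ coprod.desc 0 (𝟙 D) =
        coprod.desc (0 : A ⨿ B ⟶ D) (𝟙 D) := by
      apply coprod.hom_ext <;> simp
    rw [← h, cosmash₃ι_23_assoc])

@[simp] lemma cosmash₃Incl_ι (A B D : V.Alg) :
    cosmash₃Incl A B D ≫ cosmashι (A ⨿ B) D = cosmash₃ι A B D := cosmashLift_ι _ _ _

lemma cosmashMap_zero_left {A A' B B' : V.Alg} (g : B ⟶ B') :
    cosmashMap (0 : A ⟶ A') g = 0 := by
  have h : coprod.map (0 : A ⟶ A') g = coprod.desc 0 (𝟙 B) ≫ g ≫ coprod.inr := by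
    apply coprod.hom_ext
    · rw [coprod.inl_map, zero_comp, coprod.inl_desc_assoc, zero_comp]
    · rw [coprod.inr_map, coprod.inr_desc_assoc, Category.id_comp]
  rw [← cancel_mono (cosmashι A' B'), cosmashMap_ι, h, cosmashι_right_assoc, zero_comp]

/-- The cosmash product `(A + B) ⋄ D` is generated by `A ⋄ D`, `B ⋄ D` and `A ⋄ B ⋄ D`. -/
lemma cosmash_coprod_hom_ext {A B D W : V.Alg} {f g : cosmash (A ⨿ B) D ⟶ W}
    (h₁ : cosmashMap coprod.inl (𝟙 D) ≫ f = cosmashMap coprod.inl (𝟙 D) ≫ g)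
    (h₂ : cosmashMap coprod.inr (𝟙 D) ≫ f = cosmashMap coprod.inr (𝟙 D) ≫ g)
    (h₃ : cosmash₃Incl A B D ≫ f = cosmash₃Incl A B D ≫ g) : f = g := by
  let r₁ : cosmash (A ⨿ B) D ⟶ cosmash A D := cosmashMap (coprod.desc (𝟙 A) 0) (𝟙 D)
  let r₂ : cosmash (A ⨿ B) D ⟶ cosmash B D := cosmashMap (coprod.desc 0 (𝟙 B)) (𝟙 D)
  have e₁ : cosmashMap coprod.inl (𝟙 D) ≫ r₁ = 𝟙 _ := by
    rw [← cosmashMap_comp, coprod.inl_desc, Category.comp_id, cosmashMap_id]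
  have e₂ : cosmashMap coprod.inr (𝟙 D) ≫ r₂ = 𝟙 _ := by
    rw [← cosmashMap_comp, coprod.inr_desc, Category.comp_id, cosmashMap_id]
  have e₃ : cosmashMap coprod.inr (𝟙 D) ≫ r₁ = 0 := by
    rw [← cosmashMap_comp, coprod.inr_desc, cosmashMap_zero_left]
  -- Two nested reductions: along `r₁`, split by `A ⋄ D`, and then, inside the kernel of `r₁`, along
  -- `r₂`, split by `B ⋄ D`. What both annihilate is the ternary cosmash product.
  refine hom_ext fun z => mem_of_ap_eq r₁ (equalizer f g) ⊤
    (y := ap (cosmashMap coprod.inl (𝟙 D)) (ap r₁ z)) (fun z _ hz => ?_) trivial trivial ?_ ?_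
  · refine mem_of_ap_eq r₂ (equalizer f g) (equalizer r₁ 0)
      (y := ap (cosmashMap coprod.inr (𝟙 D)) (ap r₂ z)) (fun z hz hz' => ?_) ?_ ?_ ?_ ?_
    · obtain ⟨c, hc⟩ := exists_cosmash₃ (z := ap (cosmashι _ _) z) (ap_cosmashι_left z)
        (by
          rw [mem_equalizer, ap_zero] at hz
          rw [← ap_comp, ← cosmashMap_ι]
          exact (congrArg _ hz).trans (ap_zeroElt _))
        (by
          rw [← ap_comp, ← cosmashMap_ι]
          exact (congrArg _ hz').trans (ap_zeroElt _))
      obtain rfl : ap (cosmash₃Incl A B D) c = z := cosmashι_injective _ _ (by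
        rw [← ap_comp, cosmash₃Incl_ι, hc])
      rw [mem_equalizer, ← ap_comp, h₃, ap_comp]
    · rw [mem_equalizer, hz, ap_zero]
    · rw [mem_equalizer, ← ap_comp, e₃, ap_zero, ap_zero]
    · rw [mem_equalizer, ← ap_comp, h₂, ap_comp]
    · rw [← ap_comp (cosmashMap coprod.inr (𝟙 D)), e₂, ap_id]
  · rw [mem_equalizer, ← ap_comp, h₁, ap_comp]
  · rw [← ap_comp (cosmashMap coprod.inl (𝟙 D)), e₁, ap_id]

end Protomodular

/-! ### Crossed modules as internal groupoids -/

section CrossedModules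

variable [HasZeroMorphisms V.Alg] [SemiAbelian V.Alg]

/-- The codomain morphism of the internal groupoid of a crossed module. -/
lemma exists_codomain (M : XMod V.Alg) (S : SplitExt M.X M.A)
    (hS : M.ψ ≫ S.k = cosmashι M.A M.X ≫ coprod.desc S.s S.k) :
    ∃ c : S.E ⟶ M.A, S.s ≫ c = 𝟙 M.A ∧ S.k ≫ c = M.bd := by
  refine exists_splitExt_desc S hS (𝟙 M.A) M.bd ?_
  rw [M.precrossed, conj, cosmashMap_ι_assoc]
  congr 1
  apply coprod.hom_ext <;> simp

/-- The semidirect product of a crossed module acts on the kernel by conjugation, and this action is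
the pullback of the action of the crossed module along the codomain morphism. -/
lemma kernelCore_eq (M : XMod V.Alg) (S : SplitExt M.X M.A)
    (hS : M.ψ ≫ S.k = cosmashι M.A M.X ≫ coprod.desc S.s S.k) (c : S.E ⟶ M.A)
    (hs : S.s ≫ c = 𝟙 M.A) (hk : S.k ≫ c = M.bd) :
    XMod.kernelCore S.k S.p S.zero S.isKernel.some = cosmashMap c (𝟙 M.X) ≫ M.ψ := by
  have := mono_of_isKernel S.k S.p S.zero S.isKernel.some
  let q : cosmash (M.A ⨿ M.X) M.X ⟶ cosmash S.E M.X :=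
    cosmashMap (coprod.desc S.s S.k) (𝟙 M.X)
  have hq : Function.Surjective (ap q) :=
    cosmashMap_surjective (desc_surjective S) fun x => ⟨x, rfl⟩
  have hqc : q ≫ cosmashMap c (𝟙 M.X) = cosmashMap (coprod.desc (𝟙 M.A) M.bd) (𝟙 M.X) := by
    rw [← cosmashMap_comp, Category.comp_id, coprod.desc_comp, hs, hk]
  have hqk : q ≫ XMod.kernelCore S.k S.p S.zero S.isKernel.some ≫ S.k =
      cosmashι _ _ ≫ coprod.desc (coprod.desc S.s S.k) S.k := by
    rw [XMod.kernelCore_comp, cosmashMap_ι_assoc, coprod.map_desc]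
    simp
  suffices h : q ≫ XMod.kernelCore S.k S.p S.zero S.isKernel.some ≫ S.k =
      q ≫ cosmashMap c (𝟙 M.X) ≫ M.ψ ≫ S.k by
    rw [← cancel_mono S.k]
    refine hom_ext fun z => ?_
    obtain ⟨y, rfl⟩ := hq z
    rw [← ap_comp, h, Category.assoc, ← ap_comp]
  rw [hqk, ← Category.assoc q, hqc]
  -- On `A ⋄ X` the equation is `hS`, on `X ⋄ X` the Peiffer condition, and on `A ⋄ X ⋄ X` the
  -- ternary commutator condition.
  apply cosmash_coprod_hom_ext
  · rw [cosmashMap_ι_assoc, coprod.map_desc, ← Category.assoc (cosmashMap _ _) (cosmashMap _ _),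
      ← cosmashMap_comp]
    simp only [coprod.inl_desc, Category.id_comp, Category.comp_id, cosmashMap_id, hS]
  · rw [cosmashMap_ι_assoc, coprod.map_desc, ← Category.assoc (cosmashMap _ _) (cosmashMap _ _),
      ← cosmashMap_comp, coprod.inr_desc, coprod.inr_desc, Category.comp_id, Category.id_comp,
      ← Category.assoc (cosmashMap _ _), ← M.peiffer, conj, Category.assoc, coprod.desc_comp,
      Category.id_comp]
  · have h : cosmash₃Incl M.A M.X M.X ≫ cosmashMap (coprod.desc (𝟙 M.A) M.bd) (𝟙 M.X) =
        cosmash₃Map (𝟙 M.A) M.bd (𝟙 M.X) ≫ fold₂₁ M.A M.X := by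
      rw [← cancel_mono (cosmashι M.A M.X), Category.assoc, Category.assoc, cosmashMap_ι,
        fold₂₁_ι, ← Category.assoc, cosmash₃Incl_ι, cosmash₃Map_ι_assoc]
      congr 1
      simp
    rw [← Category.assoc (cosmash₃Incl _ _ _), ← Category.assoc (cosmash₃Incl _ _ _),
      cosmash₃Incl_ι, h, Category.assoc, ← Category.assoc (fold₂₁ _ _),
      ← Category.assoc (cosmash₃Map _ _ _), ← M.ternary, Category.assoc, hS, fold₁₂_ι_assoc]
    congr 1
    rw [coprod.desc_comp, Category.id_comp, coprod.inr_desc]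


/-- A morphism from a split extension to the split extension of a crossed module is a functor of
internal groupoids. -/
lemma kernelCore_comp_eq (N : XMod V.Alg) (R : SplitExt N.X N.A)
    (hR : N.ψ ≫ R.k = cosmashι N.A N.X ≫ coprod.desc R.s R.k) (c : R.E ⟶ N.A)
    (hs : R.s ≫ c = 𝟙 N.A) (hk : R.k ≫ c = N.bd) {Y B : V.Alg} (D : SplitExt Y B)
    (l : D.E ⟶ R.E) (f : Y ⟶ N.X) (hf : f ≫ R.k = D.k ≫ l) :
    XMod.kernelCore D.k D.p D.zero D.isKernel.some ≫ f = cosmashMap (l ≫ c) f ≫ N.ψ := by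
  have := mono_of_isKernel R.k R.p R.zero R.isKernel.some
  have e : cosmashMap (l ≫ c) f = cosmashMap l f ≫ cosmashMap c (𝟙 N.X) := by
    rw [← cosmashMap_comp, Category.comp_id]
  rw [← cancel_mono R.k, Category.assoc, hf, ← Category.assoc, XMod.kernelCore_comp, e,
    Category.assoc (cosmashMap _ _), ← kernelCore_eq N R hR c hs hk,
    Category.assoc (cosmashMap _ _), XMod.kernelCore_comp, cosmashMap_ι_assoc, Category.assoc]
  congr 1
  rw [coprod.desc_comp, coprod.map_desc, hf, Category.id_comp, Category.comp_id]

/-- An equivariant pair extends to the semidirect products. -/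
lemma exists_splitExt_hom (N : XMod V.Alg) (R : SplitExt N.X N.A)
    (hR : N.ψ ≫ R.k = cosmashι N.A N.X ≫ coprod.desc R.s R.k) {Y B : V.Alg} (D : SplitExt Y B)
    (f : Y ⟶ N.X) (g : D.E ⟶ N.A)
    (h : XMod.kernelCore D.k D.p D.zero D.isKernel.some ≫ f = cosmashMap g f ≫ N.ψ) :
    ∃ l : D.E ⟶ R.E, D.s ≫ l = D.s ≫ g ≫ R.s ∧ D.k ≫ l = f ≫ R.k := by
  -- The action core belonging to `D` itself is the conjugation core of `D.E` restricted along the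
  -- section.
  refine exists_splitExt_desc D (ψ := cosmashMap D.s (𝟙 _) ≫
    XMod.kernelCore D.k D.p D.zero D.isKernel.some) ?_ _ _ ?_
  · rw [Category.assoc, XMod.kernelCore_comp, cosmashMap_ι_assoc, coprod.map_desc,
      Category.comp_id, Category.id_comp]
  · rw [Category.assoc, ← Category.assoc (XMod.kernelCore _ _ _ _), h, Category.assoc, hR,
      ← Category.assoc (cosmashMap _ _), ← cosmashMap_comp, cosmashMap_ι_assoc,
      coprod.map_desc, Category.id_comp, Category.assoc]

/-! ### The crossed module freely generated by two sets -/

variable (V) in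
/-- The split extension of the free algebra on `S` that is freely generated by the set `T`. -/
abbrev freeExt (S T : Type u) : SplitExt (kernel (proj V S T)) (free V S) where
  E := free V (S ⊕ T)
  k := kernel.ι _
  p := proj V S T
  s := sect V S T
  splitting := sect_proj S T
  zero := kernel.condition _
  isKernel := ⟨kernelIsKernel _⟩

variable (V) in
/-- The crossed module freely generated by elements of `A` indexed by `S` and elements of `X`
indexed by `T`. -/
abbrev freeXMod (S T : Type u) : XMod V.Alg := XMod.ofSplitExt (freeExt V S T)

lemma exists_genX {S T : Type u} (t : T) :
    ∃ x, ap (kernel.ι (proj V S T)) x = gen (Sum.inr t) :=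
  exists_of_isKernel (freeExt V S T).isKernel.some rfl

/-- The generators in the kernel. -/
def genX {S T : Type u} (t : T) : (kernel (proj V S T)).carrier := (exists_genX t).choose

@[simp] lemma ap_ι_genX {S T : Type u} (t : T) :
    ap (kernel.ι (proj V S T)) (genX t) = gen (Sum.inr t) := (exists_genX t).choose_spec

/-- The component at `A` of a morphism on a free crossed module. -/
def compA {S T : Type u} {N : XMod V.Alg} (f : freeXMod V S T ⟶ N) : free V (S ⊕ T) ⟶ N.A := f.fA

/-- The component at `X` of a morphism on a free crossed module. -/
def compX {S T : Type u} {N : XMod V.Alg} (f : freeXMod V S T ⟶ N) :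
    kernel (proj V S T) ⟶ N.X := f.fX

lemma comp_comm {S T : Type u} {N : XMod V.Alg} (f : freeXMod V S T ⟶ N) :
    kernel.ι (proj V S T) ≫ compA f = compX f ≫ N.bd := f.comm

lemma exists_freeXMod_hom {S T : Type u} (N : XMod V.Alg) (a : S → N.A.carrier)
    (x : T → N.X.carrier) : ∃ f : freeXMod V S T ⟶ N,
      (∀ s, ap (compA f) (gen (Sum.inl s)) = a s) ∧ ∀ t, ap (compX f) (genX t) = x t := by
  obtain ⟨R, hR⟩ := N.isActionCore
  obtain ⟨c, hs, hk⟩ := exists_codomain N R hR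
  -- Generators indexed by `S` go to identity arrows, those indexed by `T` to arrows with domain
  -- zero. Following `l` by the codomain `c` gives the component at `A`.
  let l : free V (S ⊕ T) ⟶ R.E := lift (Sum.elim (fun s => ap R.s (a s)) fun t => ap R.k (x t))
  have hlp : l ≫ R.p = proj V S T ≫ lift a := free_hom_ext (by
    rintro (s | t)
    · exact congrArg (fun f => ap f (a s)) R.splitting
    · change ap (R.k ≫ R.p) (x t) = ap (lift a) (zeroElt _)
      rw [R.zero, ap_zero, ap_zeroElt])
  obtain ⟨f, hf⟩ : ∃ f : kernel (proj V S T) ⟶ N.X, f ≫ R.k = kernel.ι (proj V S T) ≫ l :=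
    ⟨_, (KernelFork.IsLimit.lift' R.isKernel.some (kernel.ι (proj V S T) ≫ l) (by
      rw [Category.assoc, hlp, kernel.condition_assoc, zero_comp])).2⟩
  have comm : kernel.ι (proj V S T) ≫ l ≫ c = f ≫ N.bd := by
    rw [← hk, ← Category.assoc, ← Category.assoc, hf]
  refine ⟨⟨f, l ≫ c, comm, kernelCore_comp_eq N R hR c hs hk (freeExt V S T) l f hf⟩,
    fun s => ?_, fun t => injective_of_isKernel R.isKernel.some ?_⟩
  · exact congrArg (fun f => ap f (a s)) hs
  · change ap (f ≫ R.k) _ = _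
    rw [hf, ap_comp, ap_ι_genX]
    rfl

/-- The elements `genX t` need not generate the kernel as an algebra. Both morphisms are therefore
extended to the semidirect product, where they are compared on the generators of a free algebra. -/
lemma freeXMod_hom_ext {S T : Type u} {N : XMod V.Alg} {f g : freeXMod V S T ⟶ N}
    (h : ∀ s, ap (compA f) (gen (Sum.inl s)) = ap (compA g) (gen (Sum.inl s)))
    (h' : ∀ t, ap (compX f) (genX t) = ap (compX g) (genX t)) : f = g := by
  obtain ⟨R, hR⟩ := N.isActionCore
  have := mono_of_isKernel R.k R.p R.zero R.isKernel.some
  have hA : compA f = compA g := free_hom_ext (by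
    rintro (s | t)
    · exact h s
    · rw [← ap_ι_genX, ← ap_comp, comp_comm, ap_comp, h', ← ap_comp, ← comp_comm, ap_comp])
  obtain ⟨l, hl, hl'⟩ := exists_splitExt_hom N R hR (freeExt V S T) (compX f) (compA f)
    f.equivariant
  obtain ⟨m, hm, hm'⟩ := exists_splitExt_hom N R hR (freeExt V S T) (compX g) (compA g)
    g.equivariant
  have e : l = m := free_hom_ext (by
    rintro (s | t)
    · change ap (sect V S T ≫ l) (gen s) = ap (sect V S T ≫ m) (gen s)
      rw [hl, hm, hA]
    · rw [← ap_ι_genX, ← ap_comp, hl', ← ap_comp, hm', ap_comp, ap_comp, h'])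
  refine XMod.Hom.ext ?_ hA
  change compX f = compX g
  rw [← cancel_mono R.k, ← hl', ← hm', e]

end CrossedModules

/-! ### Regular epimorphisms of split extensions and of crossed modules -/

section RegularEpi

variable [HasZeroMorphisms V.Alg] [SemiAbelian V.Alg]

/-- The image of a morphism of split extensions. -/
lemma exists_image_splitExt {X X' B B' IX IB : V.Alg} (S : SplitExt X B) (S' : SplitExt X' B')
    (g : S.E ⟶ S'.E) {f₁ : X ⟶ IX} {f₂ : IX ⟶ X'} {h₁ : B ⟶ IB} {h₂ : IB ⟶ B'}
    (hk : S.k ≫ g = (f₁ ≫ f₂) ≫ S'.k) (hp : g ≫ S'.p = S.p ≫ h₁ ≫ h₂)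
    (hs : S.s ≫ g = (h₁ ≫ h₂) ≫ S'.s)
    (hf₁ : Function.Surjective (ap f₁)) (hf₂ : Function.Injective (ap f₂))
    (hh₁ : Function.Surjective (ap h₁)) (hh₂ : Function.Injective (ap h₂)) :
    ∃ (I : SplitExt IX IB) (e : S.E ⟶ I.E) (m : I.E ⟶ S'.E), Function.Injective (ap m) ∧
      e ≫ m = g ∧ I.k ≫ m = f₂ ≫ S'.k ∧ m ≫ S'.p = I.p ≫ h₂ ∧ I.s ≫ m = h₂ ≫ S'.s := by
  obtain ⟨I, e, m, he, hm, rfl⟩ := exists_image g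
  obtain ⟨k, hkm, hk'⟩ := exists_fill f₁ hf₁ m hm (S.k ≫ e) (f₂ ≫ S'.k)
    (by rw [Category.assoc, hk, Category.assoc])
  obtain ⟨p, hpm, hp'⟩ := exists_fill e he h₂ hh₂ (S.p ≫ h₁) (m ≫ S'.p)
    (by rw [← Category.assoc, hp, Category.assoc])
  obtain ⟨s, hsm, hs'⟩ := exists_fill h₁ hh₁ m hm (S.s ≫ e) (h₂ ≫ S'.s)
    (by rw [Category.assoc, hs, Category.assoc])
  have := mono_of_injective h₂ hh₂
  have zero : k ≫ p = 0 := by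
    rw [← cancel_mono h₂, Category.assoc, hpm, ← Category.assoc, hkm, Category.assoc, S'.zero,
      comp_zero, zero_comp]
  refine ⟨⟨I, k, p, s, ?_, zero, isKernel_of_injective zero (fun x y h => hf₂ ?_)
    fun a ha => ?_⟩, e, m, hm, rfl, hkm, hpm.symm, hsm⟩
  · rw [← cancel_mono h₂, Category.assoc, hpm, ← Category.assoc, hsm, Category.assoc,
      S'.splitting, Category.comp_id, Category.id_comp]
  · apply injective_of_isKernel S'.isKernel.some
    rw [← ap_comp, ← hkm, ap_comp, h, ← ap_comp, hkm, ap_comp]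
  · obtain ⟨z, rfl⟩ := he a
    -- Modulo the kernel of `S.p`, the element `z` equals `s (p z)`, which `e` sends to zero because
    -- `h₁` kills `p z`.
    obtain ⟨x, -, hx⟩ : ap e z ∈ image k ⊤ := by
      refine mem_of_ap_eq S.p (preimage e (image k ⊤)) ⊤ (y := ap S.s (ap S.p z))
        (fun b _ hb => ?_) trivial trivial ?_ ?_
      · obtain ⟨x, rfl⟩ := exists_of_isKernel S.isKernel.some hb
        rw [mem_preimage, ← ap_comp, ← hk', ap_comp]
        exact ⟨_, trivial, rfl⟩
      · have : ap h₁ (ap S.p z) = zeroElt _ := by rw [← ap_comp, ← hp', ap_comp, ha]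
        rw [mem_preimage, ← ap_comp, ← hs', ap_comp, this, ap_zeroElt]
        exact zeroElt_mem _
      · rw [← ap_comp S.s, S.splitting, ap_id]
    exact ⟨x, hx⟩

/-- The image is again a split extension over `B`; a regular epimorphism factoring through this
subobject splits its inclusion. -/
lemma SSE.surjective_of_isRegularEpi {B : V.Alg} {S T : SSE B} (e : S ⟶ T)
    [IsRegularEpi e] : Function.Surjective (ap e.f) := by
  obtain ⟨X, f₁, f₂, hf₁, hf₂, hf⟩ := exists_image e.f
  obtain ⟨I, e', m, hm, hem, hk, hp, hs⟩ := exists_image_splitExt S.ext T.ext e.g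
    (f₁ := f₁) (f₂ := f₂) (h₁ := 𝟙 B) (h₂ := 𝟙 B) (by rw [hf, e.comm_k])
    (by rw [e.comm_p, Category.id_comp, Category.comp_id])
    (by rw [e.comm_s, Category.id_comp, Category.id_comp]) hf₁ hf₂ (fun x => ⟨x, rfl⟩)
    fun _ _ h => h
  rw [Category.comp_id] at hp
  rw [Category.id_comp] at hs
  have := mono_of_injective m hm
  have := mono_of_injective f₂ hf₂
  let m' : SSE.mk X I ⟶ T := ⟨f₂, m, hk, hp, hs⟩
  let e₁ : S ⟶ SSE.mk X I := ⟨f₁, e',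
    by rw [← cancel_mono m, Category.assoc, Category.assoc, hem, hk, e.comm_k, ← hf,
      Category.assoc],
    by rw [← hp, ← Category.assoc, hem, e.comm_p],
    by rw [← cancel_mono m, Category.assoc, hem, hs, e.comm_s]⟩
  have : Mono m' := ⟨fun a b h => SSE.Hom.ext
    ((cancel_mono f₂).1 (congrArg SSE.Hom.f h)) ((cancel_mono m).1 (congrArg SSE.Hom.g h))⟩
  obtain ⟨d, hd⟩ := exists_section_of_isRegularEpi (f := e) (e := e₁) (m := m')
    (SSE.Hom.ext hf hem)
  intro x
  obtain ⟨y, hy⟩ := hf₁ (ap d.f x)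
  have h := congrArg (fun k : T ⟶ T => ap k.f x) hd
  refine ⟨y, ?_⟩
  rw [← hf, ap_comp, hy]
  exact h

/-! ### Naturality of conjugation and folding, and images of crossed modules. -/

lemma conj_comp {A B : V.Alg} (f : A ⟶ B) : conj A ≫ f = cosmashMap f f ≫ conj B := by
  rw [conj, conj, cosmashMap_ι_assoc, Category.assoc, coprod.desc_comp, coprod.map_desc,
    Category.id_comp, Category.comp_id]

lemma fold₁₂_comp {A A' B B' : V.Alg} (f : A ⟶ A') (g : B ⟶ B') :
    fold₁₂ A B ≫ cosmashMap f g = cosmash₃Map f g g ≫ fold₁₂ A' B' := by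
  rw [← cancel_mono (cosmashι A' B'), Category.assoc, Category.assoc, cosmashMap_ι, fold₁₂_ι,
    fold₁₂_ι_assoc, cosmash₃Map_ι_assoc]
  congr 1
  apply coprod.hom_ext <;> simp

lemma fold₂₁_comp {A A' B B' : V.Alg} (f : A ⟶ A') (g : B ⟶ B') :
    fold₂₁ A B ≫ cosmashMap f g = cosmash₃Map f f g ≫ fold₂₁ A' B' := by
  rw [← cancel_mono (cosmashι A' B'), Category.assoc, Category.assoc, cosmashMap_ι, fold₂₁_ι,
    fold₂₁_ι_assoc, cosmash₃Map_ι_assoc]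
  congr 1
  simp

lemma cosmash₃Map_comp {A A' A'' B B' B'' D D' D'' : V.Alg} (f : A ⟶ A') (f' : A' ⟶ A'')
    (g : B ⟶ B') (g' : B' ⟶ B'') (h : D ⟶ D') (h' : D' ⟶ D'') :
    cosmash₃Map (f ≫ f') (g ≫ g') (h ≫ h') = cosmash₃Map f g h ≫ cosmash₃Map f' g' h' := by
  rw [← cancel_mono (cosmash₃ι A'' B'' D'')]
  simp

lemma XMod.mono_of_injective {M N : XMod V.Alg} (m : M ⟶ N)
    (hX : Function.Injective (ap m.fX)) (hA : Function.Injective (ap m.fA)) : Mono m where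
  right_cancellation a b h := by
    have := Variety.mono_of_injective m.fX hX
    have := Variety.mono_of_injective m.fA hA
    exact XMod.Hom.ext ((cancel_mono m.fX).1 (congrArg XMod.Hom.fX h))
      ((cancel_mono m.fA).1 (congrArg XMod.Hom.fA h))

/-- Every morphism of crossed modules factors as a componentwise surjective morphism followed by a
componentwise injective one. -/
lemma XMod.exists_image {M N : XMod V.Alg} (e : M ⟶ N) :
    ∃ (I : XMod V.Alg) (e₁ : M ⟶ I) (m : I ⟶ N), e₁ ≫ m = e ∧
      Function.Surjective (ap e₁.fX) ∧ Function.Surjective (ap e₁.fA) ∧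
      Function.Injective (ap m.fX) ∧ Function.Injective (ap m.fA) := by
  obtain ⟨R, hR⟩ := M.isActionCore
  obtain ⟨R', hR'⟩ := N.isActionCore
  obtain ⟨g, hgs, hgk⟩ := exists_splitExt_desc R hR (e.fA ≫ R'.s) (e.fX ≫ R'.k) (by
    rw [← Category.assoc M.ψ, e.equivariant, Category.assoc, hR', cosmashMap_ι_assoc,
      coprod.map_desc])
  have hgp : g ≫ R'.p = R.p ≫ e.fA := by
    apply splitExt_hom_ext R
    · rw [← Category.assoc, hgs, Category.assoc, R'.splitting, ← Category.assoc, R.splitting,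
        Category.comp_id, Category.id_comp]
    · rw [← Category.assoc, hgk, Category.assoc, R'.zero, ← Category.assoc, R.zero, comp_zero,
        zero_comp]
  obtain ⟨X, f₁, f₂, hf₁, hf₂, hf⟩ := Variety.exists_image e.fX
  obtain ⟨A, h₁, h₂, hh₁, hh₂, hh⟩ := Variety.exists_image e.fA
  obtain ⟨I, -, m, hm, -, hk, hp, hs⟩ := exists_image_splitExt R R' g
    (f₁ := f₁) (f₂ := f₂) (h₁ := h₁) (h₂ := h₂) (by rw [hf, hgk]) (by rw [hh, hgp])
    (by rw [hh, hgs]) hf₁ hf₂ hh₁ hh₂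
  have := Variety.mono_of_injective m hm
  have := Variety.mono_of_injective f₂ hf₂
  have := Variety.mono_of_injective h₂ hh₂
  -- Surjectivity of `cosmashMap h₁ f₁` lets the action pass to the image. The axioms then follow
  -- from those of `N`, since `f₂` and `h₂` are monic.
  obtain ⟨ψ, hψ, hψ'⟩ := exists_fill (cosmashMap h₁ f₁) (cosmashMap_surjective hh₁ hf₁) f₂ hf₂
    (M.ψ ≫ f₁) (cosmashMap h₂ f₂ ≫ N.ψ)
    (by rw [← Category.assoc, ← cosmashMap_comp, hf, hh, Category.assoc, hf, e.equivariant])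
  obtain ⟨bd, hbd, hbd'⟩ := exists_fill f₁ hf₁ h₂ hh₂ (M.bd ≫ h₁) (f₂ ≫ N.bd)
    (by rw [← Category.assoc, hf, Category.assoc, hh, e.comm])
  have hswap {D : V.Alg} (d : D ⟶ A) : cosmashMap d (𝟙 X) ≫ cosmashMap h₂ f₂ =
      cosmashMap (d ≫ h₂) f₂ := by rw [← cosmashMap_comp, Category.id_comp]
  refine ⟨⟨X, A, ψ, bd, ⟨I, ?_⟩, ?_, ?_, ?_⟩, ⟨f₁, h₁, hbd'.symm, hψ'.symm⟩,
    ⟨f₂, h₂, hbd, hψ⟩, XMod.Hom.ext hf hh, hf₁, hh₁, hf₂, hh₂⟩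
  · rw [← cancel_mono m, Category.assoc, hk, ← Category.assoc, hψ, Category.assoc, hR',
      cosmashMap_ι_assoc, Category.assoc, coprod.map_desc, coprod.desc_comp, hk, hs]
  · rw [← cancel_mono h₂, Category.assoc, hbd, ← Category.assoc, hψ, Category.assoc,
      N.precrossed, Category.assoc, conj_comp, ← Category.assoc, ← Category.assoc,
      ← cosmashMap_comp, ← cosmashMap_comp, hbd, Category.id_comp, Category.comp_id]
  · rw [← cancel_mono f₂, conj_comp, N.peiffer, Category.assoc, hψ,
      ← Category.assoc (cosmashMap f₂ f₂), ← Category.assoc (cosmashMap bd (𝟙 X)), hswap,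
      ← cosmashMap_comp, hbd, Category.comp_id]
  · rw [← cancel_mono f₂, Category.assoc, Category.assoc, Category.assoc, hψ,
      ← Category.assoc (fold₁₂ _ _), fold₁₂_comp, ← Category.assoc (fold₂₁ _ _), fold₂₁_comp,
      Category.assoc, N.ternary, Category.assoc, ← Category.assoc (cosmash₃Map _ _ _),
      ← Category.assoc (cosmash₃Map _ _ _), ← cosmash₃Map_comp, ← cosmash₃Map_comp, hbd]
    simp only [Category.id_comp, Category.comp_id]

lemma XMod.surjective_of_isRegularEpi {M N : XMod V.Alg} (e : M ⟶ N) [IsRegularEpi e] :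
    Function.Surjective (ap e.fX) ∧ Function.Surjective (ap e.fA) := by
  obtain ⟨I, e₁, m, rfl, hX, hA, hX', hA'⟩ := XMod.exists_image e
  have := XMod.mono_of_injective m hX' hA'
  obtain ⟨d, hd⟩ := exists_section_of_isRegularEpi (e := e₁) (m := m) rfl
  constructor
  · intro x
    obtain ⟨y, hy⟩ := hX (ap d.fX x)
    refine ⟨y, (congrArg (ap m.fX) hy).trans ?_⟩
    exact congrArg (fun k : N ⟶ N => ap k.fX x) hd
  · intro x
    obtain ⟨y, hy⟩ := hA (ap d.fA x)
    refine ⟨y, (congrArg (ap m.fA) hy).trans ?_⟩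
    exact congrArg (fun k : N ⟶ N => ap k.fA x) hd

/-! ### Projectivity of free split extensions and free crossed modules -/

lemma isRegularProjective_freeXMod (S T : Type u) : IsRegularProjective (freeXMod V S T) := by
  intro M N e _ f
  obtain ⟨hX, hA⟩ := XMod.surjective_of_isRegularEpi e
  choose a ha using fun s => hA (ap (compA f) (gen (Sum.inl s)))
  choose x hx using fun t => hX (ap (compX f) (genX t))
  obtain ⟨g, hg, hg'⟩ := exists_freeXMod_hom M a x
  refine ⟨g, freeXMod_hom_ext (fun s => ?_) fun t => ?_⟩
  · exact (congrArg (ap e.fA) (hg s)).trans (ha s)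
  · exact (congrArg (ap e.fX) (hg' t)).trans (hx t)

lemma isRegularProjective_freeExt (S T : Type u) :
    IsRegularProjective (SSE.mk (kernel (proj V S T)) (freeExt V S T)) := by
  intro M N e _ f
  have hX := SSE.surjective_of_isRegularEpi e
  let fX : kernel (proj V S T) ⟶ N.X := f.f
  choose x hx using fun t => hX (ap fX (genX t))
  let l : free V (S ⊕ T) ⟶ M.ext.E :=
    lift (Sum.elim (fun s => ap M.ext.s (gen s)) fun t => ap M.ext.k (x t))
  have hl : l ≫ M.ext.p = proj V S T := free_hom_ext (by
    rintro (s | t)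
    · exact congrArg (fun f => ap f (gen s)) M.ext.splitting
    · change ap (M.ext.k ≫ M.ext.p) (x t) = zeroElt _
      rw [M.ext.zero, ap_zero])
  obtain ⟨k, hk⟩ : ∃ k : kernel (proj V S T) ⟶ M.X, k ≫ M.ext.k = kernel.ι (proj V S T) ≫ l :=
    ⟨_, (KernelFork.IsLimit.lift' M.ext.isKernel.some (kernel.ι (proj V S T) ≫ l) (by
      rw [Category.assoc, hl, kernel.condition])).2⟩
  have := mono_of_isKernel N.ext.k N.ext.p N.ext.zero N.ext.isKernel.some
  have hg : l ≫ e.g = f.g := free_hom_ext (by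
    rintro (s | t)
    · change ap (M.ext.s ≫ e.g) (gen s) = ap (sect V S T ≫ f.g) (gen s)
      rw [e.comm_s]
      exact congrArg (fun k => ap k (gen s)) f.comm_s.symm
    · change ap (M.ext.k ≫ e.g) (x t) = _
      rw [e.comm_k, ap_comp, hx, ← ap_ι_genX]
      exact congrArg (fun k => ap k (genX t)) f.comm_k.symm)
  refine ⟨⟨k, l, hk.symm, hl, free_hom_ext fun s => rfl⟩, SSE.Hom.ext ?_ hg⟩
  change k ≫ e.f = f.f
  rw [← cancel_mono N.ext.k, Category.assoc, ← e.comm_k, ← Category.assoc, hk, Category.assoc,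
    hg]
  exact f.comm_k

end RegularEpi

section FreeCrossedModules

variable [HasZeroMorphisms V.Alg] [SemiAbelian V.Alg]

/-! ### Free crossed modules on sets -/

lemma exists_prod_elt {A B : V.Alg} (a : A.carrier) (b : B.carrier) :
    ∃ z : (A ⨯ B : V.Alg).carrier, ap prod.fst z = a ∧ ap prod.snd z = b := by
  refine ⟨ap (prod.lift (pt a) (pt b)) (gen PUnit.unit), ?_, ?_⟩
  · rw [← ap_comp, prod.lift_fst, ap_pt]
  · rw [← ap_comp, prod.lift_snd, ap_pt]

lemma prod_elt_ext {A B : V.Alg} {z z' : (A ⨯ B : V.Alg).carrier}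
    (h₁ : ap prod.fst z = ap prod.fst z') (h₂ : ap prod.snd z = ap prod.snd z') : z = z' := by
  have : pt z = pt z' := by
    apply Limits.prod.hom_ext
    · rw [pt_comp, pt_comp, h₁]
    · rw [pt_comp, pt_comp, h₂]
  rw [← ap_pt z PUnit.unit, this, ap_pt]

lemma xmodForget_map_eq_iff {M N : XMod V.Alg} (f : M ⟶ N) (z : (M.X ⨯ M.A : V.Alg).carrier)
    (w : (N.X ⨯ N.A : V.Alg).carrier) :
    (V.xmodForget.map f : V.xmodForget.obj M → V.xmodForget.obj N) z = w ↔
      ap f.fX (ap prod.fst z) = ap prod.fst w ∧ ap f.fA (ap prod.snd z) = ap prod.snd w := by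
  change ap (prod.map f.fX f.fA) z = w ↔ _
  have h₁ : ap f.fX (ap prod.fst z) = ap prod.fst (ap (prod.map f.fX f.fA) z) := by
    rw [← ap_comp, ← prod.map_fst f.fX f.fA, ap_comp]
  have h₂ : ap f.fA (ap prod.snd z) = ap prod.snd (ap (prod.map f.fX f.fA) z) := by
    rw [← ap_comp, ← prod.map_snd f.fX f.fA, ap_comp]
  rw [h₁, h₂]
  exact ⟨fun h => ⟨by rw [h], by rw [h]⟩, fun h => prod_elt_ext h.1 h.2⟩

/-- An element of `X × A` is a pair, so one generator of the product amounts to one in `X` and one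
in `A`. -/
lemma exists_free_freeXMod (S : Type u) :
    ∃ η : S → V.xmodForget.obj (freeXMod V S S), ∀ (M : XMod V.Alg) (g : S → V.xmodForget.obj M),
      ∃! f : freeXMod V S S ⟶ M, ∀ s,
        (V.xmodForget.map f : V.xmodForget.obj _ → V.xmodForget.obj M) (η s) = g s := by
  choose η h₁ h₂ using fun s : S =>
    exists_prod_elt (genX (V := V) (S := S) s) (gen (V := V) (Sum.inl s : S ⊕ S))
  have key {M : XMod V.Alg} (f : freeXMod V S S ⟶ M) (s : S) (w : (M.X ⨯ M.A : V.Alg).carrier) :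
      (V.xmodForget.map f : V.xmodForget.obj _ → V.xmodForget.obj M) (η s) = w ↔
        ap (compX f) (genX s) = ap prod.fst w ∧
          ap (compA f) (gen (Sum.inl s)) = ap prod.snd w := by
    refine (xmodForget_map_eq_iff f (η s) w).trans ?_
    rw [← h₁, ← h₂]
    rfl
  refine ⟨η, fun M g => ?_⟩
  change S → (M.X ⨯ M.A : V.Alg).carrier at g
  obtain ⟨f, hf, hf'⟩ := exists_freeXMod_hom M (fun s => ap prod.snd (g s))
    (fun s => ap prod.fst (g s))
  refine ⟨f, fun s => (key f s (g s)).2 ⟨hf' s, hf s⟩, fun f' h => ?_⟩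
  replace h := fun s => (key f' s (g s)).1 (h s)
  exact freeXMod_hom_ext (fun s => (h s).2.trans (hf s).symm)
    fun s => (h s).1.trans (hf' s).symm

lemma isFree_freeXMod (S : Type u) : IsFree V.xmodForget (freeXMod V S S) :=
  ⟨S, exists_free_freeXMod S⟩

lemma exists_iso_of_isFree {M : XMod V.Alg} (h : IsFree V.xmodForget M) :
    ∃ S : Type u, Nonempty (freeXMod V S S ≅ M) := by
  obtain ⟨S, η, h⟩ := h
  obtain ⟨η', h'⟩ := exists_free_freeXMod (V := V) S
  exact ⟨S, nonempty_iso_of_free _ h' h⟩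

/-! ### A projective crossed module that is not free -/

lemma not_isFree_freeXMod (hV : V.NonTrivial) (T : Type u) [Infinite T] :
    ¬ IsFree V.xmodForget (freeXMod V T PUnit) := by
  classical
  intro hfree
  obtain ⟨S, ⟨θ⟩⟩ := exists_iso_of_isFree hfree
  let φ : free V (S ⊕ S) ⟶ free V (T ⊕ PUnit) := compA θ.hom
  let φ' : free V (T ⊕ PUnit) ⟶ free V (S ⊕ S) := compA θ.inv
  have hφ : φ ≫ φ' = 𝟙 _ := congrArg XMod.Hom.fA θ.hom_inv_id
  have hφ' : φ' ≫ φ = 𝟙 _ := congrArg XMod.Hom.fA θ.inv_hom_id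
  have hcomm : kernel.ι (proj V S S) ≫ φ ≫ proj V T PUnit = 0 := by
    obtain ⟨g, h⟩ : ∃ g, kernel.ι (proj V S S) ≫ φ = g ≫ kernel.ι (proj V T PUnit) :=
      ⟨compX θ.hom, comp_comm θ.hom⟩
    rw [← Category.assoc, h, Category.assoc, kernel.condition, comp_zero]
  have hcomm' : kernel.ι (proj V T PUnit) ≫ φ' ≫ proj V S S = 0 := by
    obtain ⟨g, h⟩ : ∃ g, kernel.ι (proj V T PUnit) ≫ φ' = g ≫ kernel.ι (proj V S S) :=
      ⟨compX θ.inv, comp_comm θ.inv⟩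
    rw [← Category.assoc, h, Category.assoc, kernel.condition, comp_zero]
  obtain hS | hS := finite_or_infinite S
  -- For finite `S`, an algebra with finitely many generators would map onto `free V T`.
  · refine not_surjective_of_finite hV (φ ≫ proj V T PUnit) fun z =>
      ⟨ap φ' (ap (sect V T PUnit) z), ?_⟩
    rw [ap_comp, ← ap_comp φ', hφ', ap_id, ← ap_comp, sect_proj, ap_id]
  · let y : (free V (T ⊕ PUnit)).carrier := gen (Sum.inr PUnit.unit)
    have hy : ap (proj V S S) (ap φ' y) = zeroElt _ := by
      change ap (proj V S S) (ap φ' (gen (Sum.inr PUnit.unit))) = _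
      rw [← ap_ι_genX, ← ap_comp, ← ap_comp, hcomm', ap_zero]
    obtain ⟨s, hs, h⟩ := exists_finite_support (ap φ' y)
    obtain ⟨t, ht⟩ := (hs.preimage (f := Sum.inr) Sum.inr_injective.injOn).exists_notMem
    -- For infinite `S`, some `t` is missing from the support of `φ' y`. Of the generators in the
    -- kernel, `ε` keeps only this one.
    let ε : free V (S ⊕ S) ⟶ free V (S ⊕ S) :=
      lift (Sum.elim (fun i => gen (Sum.inl i)) fun i => if i = t then gen (Sum.inr t)
        else zeroElt _)
    have hεy : ap ε (ap φ' y) = zeroElt _ := by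
      -- On the support of `φ' y`, the map `ε` agrees with `proj` followed by `sect`, and `φ' y`
      -- lies in the kernel of `proj`.
      rw [h _ ε (proj V S S ≫ sect V S S), ap_comp, hy, ap_zeroElt]
      rintro (i | i) hi
      · rfl
      · have : i ≠ t := fun hit => ht (show Sum.inr t ∈ s from hit ▸ hi)
        change (if i = t then gen (Sum.inr t) else zeroElt _) = ap (sect V S S) (zeroElt _)
        rw [if_neg this, ap_zeroElt]
    have hχ : φ' ≫ ε = proj V T PUnit ≫ sect V T PUnit ≫ φ' ≫ ε := free_hom_ext (by
      rintro (i | i)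
      · rfl
      · refine hεy.trans ?_
        exact (ap_zeroElt (sect V T PUnit ≫ φ' ≫ ε)).symm)
    apply gen_ne_zeroElt hV (Sum.inr t : S ⊕ S)
    have hεt : ap ε (gen (Sum.inr t)) = gen (Sum.inr t) := by
      change (if t = t then gen (Sum.inr t) else zeroElt _) = _
      rw [if_pos rfl]
    -- As `φ' ≫ ε` kills `y`, it factors through `proj V T PUnit`. Hence `ε` vanishes on the kernel
    -- of `proj V S S`, although it fixes `gen (Sum.inr t)`.
    have hε : ε = φ ≫ proj V T PUnit ≫ sect V T PUnit ≫ φ' ≫ ε := by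
      rw [← hχ, ← Category.assoc, hφ, Category.id_comp]
    rw [← hεt, hε, ← ap_ι_genX, ← ap_comp, ← Category.assoc φ, ← Category.assoc, hcomm,
      zero_comp, ap_zero]

/-- The retraction of sets induces an algebra retraction of the `A`-component. Injectivity passes to
the `X`-component because the boundary is a kernel inclusion. -/
lemma exists_mono_freeXMod (S : Type u) {T T' : Type u} (i : T → T') (r : T' → T)
    (h : ∀ t, r (i t) = t) : ∃ f : freeXMod V S T ⟶ freeXMod V S T', Mono f := by
  obtain ⟨f, hf, hf'⟩ := exists_freeXMod_hom (freeXMod V S T')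
    (fun s => gen (V := V) (Sum.inl s : S ⊕ T')) (fun t => genX (i t))
  let φ : free V (S ⊕ T) ⟶ free V (S ⊕ T') := compA f
  let g : kernel (proj V S T) ⟶ kernel (proj V S T') := compX f
  have hφg : kernel.ι (proj V S T) ≫ φ = g ≫ kernel.ι (proj V S T') := comp_comm f
  let ρ : free V (S ⊕ T') ⟶ free V (S ⊕ T) :=
    lift (Sum.elim (fun s => gen (Sum.inl s)) fun t => gen (Sum.inr (r t)))
  have hρ : φ ≫ ρ = 𝟙 _ := free_hom_ext (by
    rintro (s | t)
    · exact congrArg (ap ρ) (hf s)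
    · have e : ap g (genX t) = genX (i t) := hf' t
      rw [← ap_ι_genX, ap_comp, ← ap_comp _ φ, hφg, ap_comp, e, ap_ι_genX, ap_id, ap_ι_genX]
      change gen (Sum.inr (r (i t))) = _
      rw [h])
  have hφ : Function.Injective (ap φ) := fun a b hab => by
    rw [← ap_id a, ← hρ, ap_comp, hab, ← ap_comp, hρ, ap_id]
  have hg : Function.Injective (ap g) := fun a b hab => by
    apply injective_of_mono (kernel.ι (proj V S T))
    apply hφ
    rw [← ap_comp, hφg, ap_comp, hab, ← ap_comp, ← hφg, ap_comp]
  exact ⟨f, XMod.mono_of_injective f hg hφ⟩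

end FreeCrossedModules

end Variety

end SemiAb

end

/-! ### The main theorem. -/

open SemiAb
theorem mainTheorem3 (V : Variety.{u}) [HasZeroMorphisms V.Alg] [SemiAbelian V.Alg]
    (hV : V.NonTrivial) :
    ¬ IsSchreier V.xmodForget ∧
    ∃ (P : V.Alg) (S : SSE P), IsRegularProjective P ∧ IsRegularProjective S ∧
      IsRegularProjective (XMod.ofSplitExt S.ext) ∧
      ¬ IsFree V.xmodForget (XMod.ofSplitExt S.ext) ∧
      ∃ (F : XMod V.Alg) (i : XMod.ofSplitExt S.ext ⟶ F), IsFree V.xmodForget F ∧ Mono i := by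
  have hnot := Variety.not_isFree_freeXMod hV (ULift.{u} ℕ)
  have hfree := Variety.isFree_freeXMod (V := V) (ULift.{u} ℕ)
  obtain ⟨i, hi⟩ := Variety.exists_mono_freeXMod (V := V) (ULift.{u} ℕ)
    (fun _ : PUnit.{u + 1} => (⟨0⟩ : ULift.{u} ℕ)) (fun _ => PUnit.unit) fun _ => rfl
  exact ⟨fun h => hnot (h i hfree), Variety.free V (ULift.{u} ℕ),
    ⟨_, Variety.freeExt V (ULift.{u} ℕ) PUnit⟩, Variety.isRegularProjective_free _,
    Variety.isRegularProjective_freeExt _ _, Variety.isRegularProjective_freeXMod _ _, hnot,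
    _, i, hfree, hi⟩
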